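/- In the Stabbing Segments with Rays (SSR) problem the input consists of $n$ pairwise disjoint horizontal leftward-directed closed rays and $m$ pairwise disjoint vertical closed segments in the plane, and the task is to select a minimum number of the rays such that every segment is intersected by a selected ray. There is an $O((n+m)\log(n+m))$-time $2$-approximation algorithm for SSR. Precisely: there is one real-RAM program which, on every instance with $n$ rays and $m$ segments, halts within $T(n+m)$ steps, where $T(N)=O(N\log N)$, and which, whenever every segment of the instance intersects at least one ray, outputs a set of rays that intersects all the segments and whose cardinality is at most twice the minimum cardinality of such a set. -/

import Mathlib

open Filter Asymptotics

/-! ## The problem: stabbing segments with rays -/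

namespace SSR

/-- A horizontal leftward-directed closed ray with right endpoint `(x, y)`. -/
structure Ray where
  x : ℝ
  y : ℝ

/-- The points of the ray. -/
def Ray.carrier (r : Ray) : Set (ℝ × ℝ) := {p | p.1 ≤ r.x ∧ p.2 = r.y}

/-- A vertical closed segment with endpoints `(x, lo)` and `(x, hi)`. -/
structure Segment where
  x : ℝ
  lo : ℝ
  hi : ℝ
  lo_le_hi : lo ≤ hi

/-- The points of the segment. -/
def Segment.carrier (v : Segment) : Set (ℝ × ℝ) := {p | p.1 = v.x ∧ v.lo ≤ p.2 ∧ p.2 ≤ v.hi}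

/-- An instance with `n` pairwise disjoint leftward-directed rays and `m` pairwise disjoint vertical
segments, listed in any order. -/
structure Problem (n m : ℕ) where
  ray : Fin n → Ray
  seg : Fin m → Segment
  ray_disjoint : ∀ i j, i ≠ j → Disjoint (ray i).carrier (ray j).carrier
  seg_disjoint : ∀ i j, i ≠ j → Disjoint (seg i).carrier (seg j).carrier

/-- The set `S` of rays intersects every segment. -/
def Problem.IsSolution {n m : ℕ} (I : Problem n m) (S : Finset (Fin n)) : Prop :=
  ∀ j : Fin m, ∃ i ∈ S, ((I.ray i).carrier ∩ (I.seg j).carrier).Nonempty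

/-- Every segment intersects some ray, that is, the instance has a solution. -/
def Problem.Feasible {n m : ℕ} (I : Problem n m) : Prop :=
  ∀ j : Fin m, ∃ i : Fin n, ((I.ray i).carrier ∩ (I.seg j).carrier).Nonempty

/-! ## The machine model: a real RAM with structured control flow

A store has registers and random-access arrays holding natural numbers, and registers and arrays
holding real numbers. Registers and arrays are named by natural numbers; a program is a finite
object and so mentions finitely many of them. Natural numbers serve as indices and are handled by
addition, truncated subtraction, halving and comparison; reals by the field operations and
comparison. There is no rounding and no conversion from reals to natural numbers. -/

/-- The store of the machine. -/
structure Store where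
  natReg : ℕ → ℕ
  natArr : ℕ → ℕ → ℕ
  realReg : ℕ → ℝ
  realArr : ℕ → ℕ → ℝ

/-- Expressions whose values are natural numbers; `get a e` reads array `a` at index `e`. -/
inductive NatExpr : Type
  | const (k : ℕ)
  | reg (v : ℕ)
  | get (a : ℕ) (e : NatExpr)
  | add (e f : NatExpr)
  | sub (e f : NatExpr)
  | half (e : NatExpr)

/-- Expressions whose values are real numbers; the only constants are rational. -/
inductive RealExpr : Type
  | const (q : ℚ)
  | reg (v : ℕ)
  | get (a : ℕ) (e : NatExpr)
  | add (e f : RealExpr)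
  | sub (e f : RealExpr)
  | mul (e f : RealExpr)
  | div (e f : RealExpr)

/-- Tests. -/
inductive Test : Type
  | natLe (e f : NatExpr)
  | realLe (e f : RealExpr)
  | neg (b : Test)
  | conj (b c : Test)

/-- Programs. -/
inductive Program : Type
  | skip
  | setNatReg (v : ℕ) (e : NatExpr)
  | setNatArr (a : ℕ) (i e : NatExpr)
  | setRealReg (v : ℕ) (e : RealExpr)
  | setRealArr (a : ℕ) (i : NatExpr) (e : RealExpr)
  | seq (P Q : Program)
  | cond (b : Test) (P Q : Program)
  | loop (b : Test) (P : Program)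

def NatExpr.eval (s : Store) : NatExpr → ℕ
  | .const k => k
  | .reg v => s.natReg v
  | .get a e => s.natArr a (e.eval s)
  | .add e f => e.eval s + f.eval s
  | .sub e f => e.eval s - f.eval s
  | .half e => e.eval s / 2

/-- The value of a real expression (with the convention `x / 0 = 0`). -/
noncomputable def RealExpr.eval (s : Store) : RealExpr → ℝ
  | .const q => (q : ℝ)
  | .reg v => s.realReg v
  | .get a e => s.realArr a (e.eval s)
  | .add e f => e.eval s + f.eval s
  | .sub e f => e.eval s - f.eval s
  | .mul e f => e.eval s * f.eval s
  | .div e f => e.eval s / f.eval s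

def Test.Holds (s : Store) : Test → Prop
  | .natLe e f => e.eval s ≤ f.eval s
  | .realLe e f => e.eval s ≤ f.eval s
  | .neg b => ¬ b.Holds s
  | .conj b c => b.Holds s ∧ c.Holds s

/-- The cost of evaluating an expression: one step for each constant, memory access and operation
in it. -/
def NatExpr.cost : NatExpr → ℕ
  | .const _ => 1
  | .reg _ => 1
  | .get _ e => e.cost + 1
  | .add e f => e.cost + f.cost + 1
  | .sub e f => e.cost + f.cost + 1
  | .half e => e.cost + 1

def RealExpr.cost : RealExpr → ℕ
  | .const _ => 1
  | .reg _ => 1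
  | .get _ e => e.cost + 1
  | .add e f => e.cost + f.cost + 1
  | .sub e f => e.cost + f.cost + 1
  | .mul e f => e.cost + f.cost + 1
  | .div e f => e.cost + f.cost + 1

def Test.cost : Test → ℕ
  | .natLe e f => e.cost + f.cost + 1
  | .realLe e f => e.cost + f.cost + 1
  | .neg b => b.cost + 1
  | .conj b c => b.cost + c.cost + 1

def Store.setNatReg (s : Store) (v : ℕ) (x : ℕ) : Store :=
  { s with natReg := Function.update s.natReg v x }

def Store.setNatArr (s : Store) (a i : ℕ) (x : ℕ) : Store :=
  { s with natArr := Function.update s.natArr a (Function.update (s.natArr a) i x) }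

noncomputable def Store.setRealReg (s : Store) (v : ℕ) (x : ℝ) : Store :=
  { s with realReg := Function.update s.realReg v x }

noncomputable def Store.setRealArr (s : Store) (a i : ℕ) (x : ℝ) : Store :=
  { s with realArr := Function.update s.realArr a (Function.update (s.realArr a) i x) }

/-- `Exec P s s' t`: started in the store `s`, the program `P` halts in the store `s'` after exactly
`t` steps. -/
inductive Exec : Program → Store → Store → ℕ → Prop
  | skip (s : Store) : Exec .skip s s 1
  | setNatReg (v : ℕ) (e : NatExpr) (s : Store) :
      Exec (.setNatReg v e) s
        (s.setNatReg v (e.eval s)) (e.cost + 1)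
  | setNatArr (a : ℕ) (i e : NatExpr) (s : Store) :
      Exec (.setNatArr a i e) s
        (s.setNatArr a (i.eval s) (e.eval s)) (i.cost + e.cost + 1)
  | setRealReg (v : ℕ) (e : RealExpr) (s : Store) :
      Exec (.setRealReg v e) s
        (s.setRealReg v (e.eval s)) (e.cost + 1)
  | setRealArr (a : ℕ) (i : NatExpr) (e : RealExpr) (s : Store) :
      Exec (.setRealArr a i e) s
        (s.setRealArr a (i.eval s) (e.eval s)) (i.cost + e.cost + 1)
  | seq {P Q : Program} {s s' s'' : Store} {t t' : ℕ} :
      Exec P s s' t → Exec Q s' s'' t' → Exec (.seq P Q) s s'' (t + t')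
  | cond_true {b : Test} {P Q : Program} {s s' : Store} {t : ℕ} :
      b.Holds s → Exec P s s' t → Exec (.cond b P Q) s s' (b.cost + t + 1)
  | cond_false {b : Test} {P Q : Program} {s s' : Store} {t : ℕ} :
      ¬ b.Holds s → Exec Q s s' t → Exec (.cond b P Q) s s' (b.cost + t + 1)
  | loop_done {b : Test} {P : Program} {s : Store} :
      ¬ b.Holds s → Exec (.loop b P) s s (b.cost + 1)
  | loop_step {b : Test} {P : Program} {s s' s'' : Store} {t t' : ℕ} :
      b.Holds s → Exec P s s' t → Exec (.loop b P) s' s'' t' →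
        Exec (.loop b P) s s'' (b.cost + t + t' + 1)

/-! ## Input and output -/

/-- A finite list of reals written into an array, the rest of which is zero. -/
noncomputable def listing {n : ℕ} (f : Fin n → ℝ) (i : ℕ) : ℝ := if h : i < n then f ⟨i, h⟩ else 0

/-- The initial store for an instance: the numbers `n` and `m` in registers `0` and `1`, the
coordinates of the rays in the real arrays `0` and `1`, those of the segments in the real arrays
`2`, `3` and `4`, and zeros everywhere else. -/
noncomputable def Problem.input {n m : ℕ} (I : Problem n m) : Store where
  natReg := fun v => match v with
    | 0 => n
    | 1 => m
    | _ => 0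
  natArr := fun _ _ => 0
  realReg := fun _ => 0
  realArr := fun a => match a with
    | 0 => listing fun i => (I.ray i).x
    | 1 => listing fun i => (I.ray i).y
    | 2 => listing fun j => (I.seg j).x
    | 3 => listing fun j => (I.seg j).lo
    | 4 => listing fun j => (I.seg j).hi
    | _ => fun _ => 0

/-- The output: the `i`-th ray is selected if and only if entry `i` of the natural-number array `0`
is nonzero. -/
def Store.output (s : Store) (n : ℕ) : Finset (Fin n) :=
  Finset.univ.filter fun i : Fin n => s.natArr 0 i ≠ 0

end SSR

namespace SSR

/-! Only the order of the coordinates matters, so they are replaced by ranks, with ties broken so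
that touching counts as intersecting (`ranksOf_stabs`). Each segment is assigned the rightmost ray
at its height. The segments are processed from left to right by the position of that ray, and
whenever no selected ray hits the current segment, its assigned ray is selected, provided that it
hits. If any ray hits the segment, the assigned one does.

The ratio is `Ranks.card_le_two_mul`. A selected ray `i` has a witness segment `w i`: `i` is the
rightmost ray at its height, and no selected ray further left hits it, because rays are selected
from left to right (`Ranks.Greedy.select`). Given any solution, charge `i` to a ray `g` of it that
hits `w i`. Suppose `i` and `i'` are both charged to `g`, with `i` to the left of `i'`. Then `g`
ends no further right than `i`, so `i` reaches the abscissa of `w i'`; as `i` does not hit `w i'`,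
it is outside the height span of `w i'`. Being further right than `i`, the ray `i'` is outside the
span of `w i`. Both spans contain the height of `g`, so if `i` and `i'` were on the same side of
`g`, the span reaching the farther of them would contain the nearer. Hence `g` is charged at most
twice.

For the running time, all data structures are implicit binary trees in arrays: point updates
(`Runs.update`), range maxima (`Runs.query`) and tournament sort (`Runs.sort`). An update or query
halves an index at each round, so it costs a logarithm, and linearly many of them are made. `Runs`
is a Hoare triple with a time bound; `Frame` supplies whatever a program leaves untouched. -/

/-- `P`, started in `s`, halts within `c` steps in a store satisfying `Q`. -/
def Runs (P : Program) (s : Store) (c : ℕ) (Q : Store → Prop) : Prop :=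
  ∃ s' t, Exec P s s' t ∧ t ≤ c ∧ Q s'

/-! ### Frames: what a program leaves alone -/

/-- Boolean-valued, so that for a concrete program and a concrete register the side conditions of
`Frame` close by `rfl`. -/
def Program.writesNatReg : Program → ℕ → Bool
  | .setNatReg v _, w => w == v
  | .seq P Q, w => P.writesNatReg w || Q.writesNatReg w
  | .cond _ P Q, w => P.writesNatReg w || Q.writesNatReg w
  | .loop _ P, w => P.writesNatReg w
  | _, _ => false

def Program.writesNatArr : Program → ℕ → Bool
  | .setNatArr v _ _, w => w == v
  | .seq P Q, w => P.writesNatArr w || Q.writesNatArr w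
  | .cond _ P Q, w => P.writesNatArr w || Q.writesNatArr w
  | .loop _ P, w => P.writesNatArr w
  | _, _ => false

def Program.writesRealArr : Program → ℕ → Bool
  | .setRealArr v _ _, w => w == v
  | .seq P Q, w => P.writesRealArr w || Q.writesRealArr w
  | .cond _ P Q, w => P.writesRealArr w || Q.writesRealArr w
  | .loop _ P, w => P.writesRealArr w
  | _, _ => false

def Program.writesRealReg : Program → ℕ → Bool
  | .setRealReg v _, w => w == v
  | .seq P Q, w => P.writesRealReg w || Q.writesRealReg w
  | .cond _ P Q, w => P.writesRealReg w || Q.writesRealReg w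
  | .loop _ P, w => P.writesRealReg w
  | _, _ => false

/-- `s'` agrees with `s` on every register and array that `P` does not write to. -/
structure Frame (P : Program) (s s' : Store) : Prop where
  natReg : ∀ v, P.writesNatReg v = false → s'.natReg v = s.natReg v
  natArr : ∀ v, P.writesNatArr v = false → s'.natArr v = s.natArr v
  realReg : ∀ v, P.writesRealReg v = false → s'.realReg v = s.realReg v
  realArr : ∀ v, P.writesRealArr v = false → s'.realArr v = s.realArr v

@[simp] theorem Store.setNatReg_natReg (s : Store) (v x w : ℕ) :
    (s.setNatReg v x).natReg w = if w = v then x else s.natReg w := by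
  simp [Store.setNatReg, Function.update_apply]
@[simp] theorem Store.setNatReg_natArr (s : Store) (v x : ℕ) :
    (s.setNatReg v x).natArr = s.natArr := rfl
@[simp] theorem Store.setNatReg_realReg (s : Store) (v x : ℕ) :
    (s.setNatReg v x).realReg = s.realReg := rfl
@[simp] theorem Store.setNatReg_realArr (s : Store) (v x : ℕ) :
    (s.setNatReg v x).realArr = s.realArr := rfl

@[simp] theorem Store.setNatArr_natReg (s : Store) (a i x : ℕ) :
    (s.setNatArr a i x).natReg = s.natReg := rfl
@[simp] theorem Store.setNatArr_natArr (s : Store) (a i x b : ℕ) :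
    (s.setNatArr a i x).natArr b =
      if b = a then Function.update (s.natArr a) i x else s.natArr b := by
  simp only [Store.setNatArr, Function.update_apply]
@[simp] theorem Store.setNatArr_realReg (s : Store) (a i x : ℕ) :
    (s.setNatArr a i x).realReg = s.realReg := rfl
@[simp] theorem Store.setNatArr_realArr (s : Store) (a i x : ℕ) :
    (s.setNatArr a i x).realArr = s.realArr := rfl

@[simp] theorem Store.setRealReg_natReg (s : Store) (v : ℕ) (x : ℝ) :
    (s.setRealReg v x).natReg = s.natReg := rfl
@[simp] theorem Store.setRealReg_natArr (s : Store) (v : ℕ) (x : ℝ) :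
    (s.setRealReg v x).natArr = s.natArr := rfl
@[simp] theorem Store.setRealReg_realReg (s : Store) (v : ℕ) (x : ℝ) (w : ℕ) :
    (s.setRealReg v x).realReg w = if w = v then x else s.realReg w := by
  simp [Store.setRealReg, Function.update_apply]
@[simp] theorem Store.setRealReg_realArr (s : Store) (v : ℕ) (x : ℝ) :
    (s.setRealReg v x).realArr = s.realArr := rfl

@[simp] theorem Store.setRealArr_natReg (s : Store) (a i : ℕ) (x : ℝ) :
    (s.setRealArr a i x).natReg = s.natReg := rfl
@[simp] theorem Store.setRealArr_natArr (s : Store) (a i : ℕ) (x : ℝ) :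
    (s.setRealArr a i x).natArr = s.natArr := rfl
@[simp] theorem Store.setRealArr_realReg (s : Store) (a i : ℕ) (x : ℝ) :
    (s.setRealArr a i x).realReg = s.realReg := rfl
@[simp] theorem Store.setRealArr_realArr (s : Store) (a i : ℕ) (x : ℝ) (b : ℕ) :
    (s.setRealArr a i x).realArr b =
      if b = a then Function.update (s.realArr a) i x else s.realArr b := by
  simp only [Store.setRealArr, Function.update_apply]

theorem Frame.refl (P : Program) (s : Store) : Frame P s s :=
  ⟨fun _ _ => rfl, fun _ _ => rfl, fun _ _ => rfl, fun _ _ => rfl⟩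

theorem Frame.of_imp {P Q : Program} {s s' : Store} (h : Frame P s s')
    (h1 : ∀ v, Q.writesNatReg v = false → P.writesNatReg v = false)
    (h2 : ∀ v, Q.writesNatArr v = false → P.writesNatArr v = false)
    (h3 : ∀ v, Q.writesRealReg v = false → P.writesRealReg v = false)
    (h4 : ∀ v, Q.writesRealArr v = false → P.writesRealArr v = false) : Frame Q s s' :=
  ⟨fun v hv => h.natReg v (h1 v hv), fun v hv => h.natArr v (h2 v hv),
    fun v hv => h.realReg v (h3 v hv), fun v hv => h.realArr v (h4 v hv)⟩

theorem Frame.trans {P : Program} {s s' s'' : Store} (h : Frame P s s') (h' : Frame P s' s'') :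
    Frame P s s'' :=
  ⟨fun v hv => (h'.natReg v hv).trans (h.natReg v hv),
    fun v hv => (h'.natArr v hv).trans (h.natArr v hv),
    fun v hv => (h'.realReg v hv).trans (h.realReg v hv),
    fun v hv => (h'.realArr v hv).trans (h.realArr v hv)⟩

theorem Exec.frame {P : Program} {s s' : Store} {t : ℕ} (h : Exec P s s' t) : Frame P s s' := by
  induction h with
  | skip s => exact Frame.refl _ _
  | setNatReg v e s | setNatArr a i e s | setRealReg v e s | setRealArr a i e s =>
    constructor <;> intro w hw <;>
      simp_all [Program.writesNatReg, Program.writesNatArr, Program.writesRealReg,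
        Program.writesRealArr]
  | @seq P Q s s' s'' t t' _ _ h1 h2 =>
    refine (h1.of_imp ?_ ?_ ?_ ?_).trans (h2.of_imp ?_ ?_ ?_ ?_) <;> intro v hv <;>
      simp_all [Program.writesNatReg, Program.writesNatArr, Program.writesRealReg,
        Program.writesRealArr]
  | cond_true _ _ h | cond_false _ _ h =>
    refine h.of_imp ?_ ?_ ?_ ?_ <;> intro v hv <;>
      simp_all [Program.writesNatReg, Program.writesNatArr, Program.writesRealReg,
        Program.writesRealArr]
  | loop_done _ => exact Frame.refl _ _
  | loop_step _ _ _ h1 h2 =>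
    refine (h1.of_imp ?_ ?_ ?_ ?_).trans h2 <;> intro v hv <;>
      simpa [Program.writesNatReg, Program.writesNatArr, Program.writesRealReg,
        Program.writesRealArr] using hv

/-! ### Rules for `Runs` -/

theorem Runs.mono {P : Program} {s : Store} {c c' : ℕ} {Q Q' : Store → Prop}
    (h : Runs P s c Q) (hc : c ≤ c') (hQ : ∀ s', Frame P s s' → Q s' → Q' s') :
    Runs P s c' Q' := by
  obtain ⟨s', t, he, ht, hq⟩ := h
  exact ⟨s', t, he, ht.trans hc, hQ s' he.frame hq⟩

theorem Runs.seq {P P' : Program} {s : Store} {c c' : ℕ} {Q R : Store → Prop}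
    (h : Runs P s c Q) (h' : ∀ s', Frame P s s' → Q s' → Runs P' s' c' R) :
    Runs (.seq P P') s (c + c') R := by
  obtain ⟨s', t, he, ht, hq⟩ := h
  obtain ⟨s'', t', he', ht', hr⟩ := h' s' he.frame hq
  exact ⟨s'', t + t', .seq he he', by omega, hr⟩

theorem Runs.cond {b : Test} {P P' : Program} {s : Store} {c : ℕ} {Q : Store → Prop}
    (h : b.Holds s → Runs P s c Q) (h' : ¬ b.Holds s → Runs P' s c Q) :
    Runs (.cond b P P') s (b.cost + c + 1) Q := by
  by_cases hb : b.Holds s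
  · obtain ⟨s', t, he, ht, hq⟩ := h hb
    exact ⟨s', _, .cond_true hb he, by omega, hq⟩
  · obtain ⟨s', t, he, ht, hq⟩ := h' hb
    exact ⟨s', _, .cond_false hb he, by omega, hq⟩

/-- A loop with invariant `I` and a variant `μ`, whose body takes at most `c` steps. -/
theorem Runs.loop {b : Test} {P : Program} {c : ℕ} (I : Store → Prop) (μ : Store → ℕ)
    (hstep : ∀ s, I s → b.Holds s → Runs P s c fun s' => I s' ∧ μ s' < μ s)
    {s : Store} (h : I s) {N : ℕ} (hN : μ s ≤ N) :
    Runs (.loop b P) s ((N + 1) * (b.cost + c + 1)) fun s' => I s' ∧ ¬ b.Holds s' := by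
  induction N generalizing s with
  | zero =>
    by_cases hb : b.Holds s
    · obtain ⟨s', t, he, ht, hq⟩ := hstep s h hb
      omega
    · exact ⟨s, _, .loop_done hb, by nlinarith, h, hb⟩
  | succ N ih =>
    by_cases hb : b.Holds s
    · obtain ⟨s', t, he, ht, hq, hμ⟩ := hstep s h hb
      obtain ⟨s'', t', he', ht', hq'⟩ := ih hq (by omega)
      exact ⟨s'', _, .loop_step hb he he', by nlinarith, hq'⟩
    · exact ⟨s, _, .loop_done hb, by nlinarith, h, hb⟩

/-! ### Loop-free programs -/

def Program.loopFree : Program → Bool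
  | .seq P Q => P.loopFree && Q.loopFree
  | .cond _ P Q => P.loopFree && Q.loopFree
  | .loop _ _ => false
  | _ => true

open Classical in
/-- The final store of a loop-free program. -/
noncomputable def Program.result : Program → Store → Store
  | .skip, s => s
  | .setNatReg v e, s => s.setNatReg v (e.eval s)
  | .setNatArr a i e, s => s.setNatArr a (i.eval s) (e.eval s)
  | .setRealReg v e, s => s.setRealReg v (e.eval s)
  | .setRealArr a i e, s => s.setRealArr a (i.eval s) (e.eval s)
  | .seq P Q, s => Q.result (P.result s)
  | .cond b P Q, s => if b.Holds s then P.result s else Q.result s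
  | .loop _ _, s => s

theorem Program.result_cond_pos {b : Test} {P Q : Program} {s : Store} (h : b.Holds s) :
    (Program.cond b P Q).result s = P.result s := if_pos h

theorem Program.result_cond_neg {b : Test} {P Q : Program} {s : Store} (h : ¬ b.Holds s) :
    (Program.cond b P Q).result s = Q.result s := if_neg h

/-- An upper bound on the running time of a loop-free program. -/
def Program.maxTime : Program → ℕ
  | .skip => 1
  | .setNatReg _ e => e.cost + 1
  | .setNatArr _ i e => i.cost + e.cost + 1
  | .setRealReg _ e => e.cost + 1
  | .setRealArr _ i e => i.cost + e.cost + 1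
  | .seq P Q => P.maxTime + Q.maxTime
  | .cond b P Q => b.cost + P.maxTime + Q.maxTime + 1
  | .loop _ _ => 0

theorem Program.exec_result (P : Program) (h : P.loopFree = true) (s : Store) :
    ∃ t, Exec P s (P.result s) t ∧ t ≤ P.maxTime := by
  induction P generalizing s with
  | skip => exact ⟨_, .skip s, le_rfl⟩
  | setNatReg v e => exact ⟨_, .setNatReg v e s, le_rfl⟩
  | setNatArr a i e => exact ⟨_, .setNatArr a i e s, le_rfl⟩
  | setRealReg v e => exact ⟨_, .setRealReg v e s, le_rfl⟩
  | setRealArr a i e => exact ⟨_, .setRealArr a i e s, le_rfl⟩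
  | seq P Q ihP ihQ =>
    simp only [Program.loopFree, Bool.and_eq_true] at h
    obtain ⟨t, ht, hle⟩ := ihP h.1 s
    obtain ⟨t', ht', hle'⟩ := ihQ h.2 (P.result s)
    exact ⟨_, .seq ht ht', by simp only [Program.maxTime]; omega⟩
  | cond b P Q ihP ihQ =>
    simp only [Program.loopFree, Bool.and_eq_true] at h
    obtain ⟨t, ht, hle⟩ := ihP h.1 s
    obtain ⟨t', ht', hle'⟩ := ihQ h.2 s
    by_cases hb : b.Holds s
    · refine ⟨b.cost + t + 1, ?_, by simp only [Program.maxTime]; omega⟩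
      rw [Program.result, if_pos hb]
      exact .cond_true hb ht
    · refine ⟨b.cost + t' + 1, ?_, by simp only [Program.maxTime]; omega⟩
      rw [Program.result, if_neg hb]
      exact .cond_false hb ht'
  | loop b P => simp [Program.loopFree] at h

theorem Runs.of_loopFree {P : Program} {s : Store} {Q : Store → Prop}
    (h : P.loopFree = true) (hQ : Q (P.result s)) : Runs P s P.maxTime Q := by
  obtain ⟨t, he, ht⟩ := P.exec_result h s
  exact ⟨_, t, he, ht, hQ⟩

theorem Runs.eq_result {P : Program} {s : Store} (h : P.loopFree = true) :
    Runs P s P.maxTime (fun s' => s' = P.result s) := Runs.of_loopFree h rfl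

theorem Runs.le {P : Program} {s : Store} {c c' : ℕ} {Q : Store → Prop} (h : Runs P s c Q)
    (hc : c ≤ c') : Runs P s c' Q := h.mono hc fun _ _ h => h

/-! ### Tournament trees -/

open Classical in
/-- The winner of `a` and `b`, where `r a b` says that `a` is at least as good as `b`. -/
noncomputable def pick (r : ℕ → ℕ → Prop) (a b : ℕ) : ℕ := if r a b then a else b

/-- The array `t` is a tournament tree with leaves at `M, …, 2 * M - 1`: the entry of each inner
node is the winner of the entries of its children. -/
def IsTree (r : ℕ → ℕ → Prop) (M : ℕ) (t : ℕ → ℕ) : Prop :=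
  ∀ i, 1 ≤ i → i < M → t i = pick r (t (i + i)) (t (i + i + 1))

/-- A match between equal entries has that entry as winner whatever `r` is, so a blank array is a
valid tree and needs no initialization. -/
theorem isTree_zero (r : ℕ → ℕ → Prop) (M : ℕ) : IsTree r M fun _ => 0 := by
  intro i _ _
  simp [pick]

/-- Follow the winner downwards; `k` is fuel, since a child has a larger index than its parent.
Nothing requires `M` to be a power of two. -/
theorem IsTree.exists_leaf {r : ℕ → ℕ → Prop} {M : ℕ} {t : ℕ → ℕ} (h : IsTree r M t) (k : ℕ) :
    ∀ i, 1 ≤ i → i < 2 * M → 2 * M ≤ i + k → ∃ q, M ≤ q ∧ q < 2 * M ∧ t i = t q := by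
  induction k with
  | zero => intro i _ _ _; omega
  | succ k ih =>
    intro i hi hi' hk
    by_cases hM : i < M
    · have := h i hi hM
      unfold pick at this
      split_ifs at this
      · obtain ⟨q, h1, h2, h3⟩ := ih (i + i) (by omega) (by omega) (by omega)
        exact ⟨q, h1, h2, this.trans h3⟩
      · obtain ⟨q, h1, h2, h3⟩ := ih (i + i + 1) (by omega) (by omega) (by omega)
        exact ⟨q, h1, h2, this.trans h3⟩
    · exact ⟨i, by omega, hi', rfl⟩

/-- Every node is at least as good as its children, and repeated halving of an index leads to the
root. -/
theorem IsTree.root_le {r : ℕ → ℕ → Prop} {M : ℕ} {t : ℕ → ℕ} (h : IsTree r M t)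
    (htot : ∀ a b, r a b ∨ r b a) (htrans : ∀ a b c, r a b → r b c → r a c) :
    ∀ i, 1 ≤ i → i < 2 * M → r (t 1) (t i) := by
  intro i
  induction i using Nat.strong_induction_on with
  | _ i ih =>
    intro hi hi'
    rcases Nat.eq_or_lt_of_le hi with rfl | hi1
    · exact (htot _ _).elim id id
    · refine htrans _ _ _ (ih (i / 2) (by omega) (by omega) (by omega)) ?_
      rw [h (i / 2) (by omega) (by omega)]
      have h2 : i = i / 2 + i / 2 ∨ i = i / 2 + i / 2 + 1 := by omega
      generalize i / 2 = j at h2 ⊢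
      unfold pick
      split_ifs with hr
      · rcases h2 with rfl | rfl
        · exact (htot _ _).elim id id
        · exact hr
      · rcases h2 with rfl | rfl
        · exact (htot _ _).resolve_left hr
        · exact (htot _ _).elim id id

/-- Recompute the entries of the nodes from register `10` up to the root of tree `T`. The test `B`
compares the registers `12` and `13`. -/
def climb (T : ℕ) (B : Test) : Program :=
  .seq (.setNatReg 12 (.get T (.add (.reg 10) (.reg 10))))
  (.seq (.setNatReg 13 (.get T (.add (.add (.reg 10) (.reg 10)) (.const 1))))
  (.seq (.cond B (.setNatArr T (.reg 10) (.reg 12)) (.setNatArr T (.reg 10) (.reg 13)))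
    (.setNatReg 10 (.half (.reg 10)))))

/-- Write register `11` to the leaf of tree `T` given by register `10`. -/
def update (T : ℕ) (B : Test) : Program :=
  .seq (.seq (.setNatArr T (.reg 10) (.reg 11)) (.setNatReg 10 (.half (.reg 10))))
    (.loop (.natLe (.const 1) (.reg 10)) (climb T B))

/-- The number of binary digits is the variant of both tree loops; this is the source of the
logarithm. -/
theorem size_half_lt {i : ℕ} (h : 1 ≤ i) : (i / 2).size < i.size := by
  have h1 : i < 2 ^ i.size := Nat.size_le.1 le_rfl
  have h2 : 0 < i.size := Nat.size_pos.2 h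
  obtain ⟨k, hk⟩ : ∃ k, i.size = k + 1 := ⟨i.size - 1, by omega⟩
  rw [hk, pow_succ] at h1
  have : (i / 2).size ≤ k := Nat.size_le.2 (by omega)
  omega

/-- The meaning of `B` is required in every store with the same real arrays, because the test runs
after registers `12` and `13` have changed. -/
theorem climb_result {T : ℕ} {B : Test} {r : ℕ → ℕ → Prop} {s : Store}
    (hB : ∀ s' : Store, s'.realArr = s.realArr →
      (B.Holds s' ↔ r (s'.natReg 12) (s'.natReg 13))) :
    ((climb T B).result s).natReg 10 = s.natReg 10 / 2 ∧
    ((climb T B).result s).realArr = s.realArr ∧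
    ((climb T B).result s).natArr T = Function.update (s.natArr T) (s.natReg 10)
      (pick r (s.natArr T (s.natReg 10 + s.natReg 10))
        (s.natArr T (s.natReg 10 + s.natReg 10 + 1))) := by
  set x := s.natArr T (s.natReg 10 + s.natReg 10) with hx
  set y := s.natArr T (s.natReg 10 + s.natReg 10 + 1) with hy
  set s2 := (s.setNatReg 12 x).setNatReg 13 y with hs2
  have h10 : s2.natReg 10 = s.natReg 10 := by simp [hs2]
  have h12 : s2.natReg 12 = x := by simp [hs2]
  have h13 : s2.natReg 13 = y := by simp [hs2]
  have hA : s2.natArr = s.natArr := rfl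
  have hB2 := hB s2 rfl
  have e : (climb T B).result s = (s2.setNatArr T (s.natReg 10) (pick r x y)).setNatReg 10
      (s.natReg 10 / 2) := by
    have e1 : (climb T B).result s = (Program.seq (.cond B (.setNatArr T (.reg 10) (.reg 12))
        (.setNatArr T (.reg 10) (.reg 13))) (.setNatReg 10 (.half (.reg 10)))).result s2 := by
      have e0 : (Program.setNatReg 13 (.get T (.add (.add (.reg 10) (.reg 10)) (.const 1)))).result
          ((Program.setNatReg 12 (.get T (.add (.reg 10) (.reg 10)))).result s) = s2 := by
        simp [Program.result, NatExpr.eval, hs2, hx, hy]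
      rw [← e0]
      rfl
    rw [e1]
    unfold pick
    rw [h12, h13] at hB2
    by_cases h : r x y
    · simp [Program.result, NatExpr.eval, h, hB2, h10, h12]
    · simp [Program.result, NatExpr.eval, h, hB2, h10, h13]
  rw [e]
  exact ⟨by simp, rfl, by simp [hA]⟩

/-- The tree equation fails at most at the node in register `10`; recomputing that node moves the
possible defect to its parent. When the register reaches `0`, which is not a node, no defect is
left. -/
theorem Runs.update {T : ℕ} {B : Test} {r : ℕ → ℕ → Prop} {s : Store} {M : ℕ}
    (hB : ∀ s' : Store, s'.realArr = s.realArr →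
      (B.Holds s' ↔ r (s'.natReg 12) (s'.natReg 13)))
    (ht : IsTree r M (s.natArr T)) (hp : M ≤ s.natReg 10) (hp' : s.natReg 10 < 2 * M) :
    Runs (update T B) s (((2 * M).size + 2) * (B.cost + 40)) fun s' =>
      IsTree r M (s'.natArr T) ∧
      ∀ i, M ≤ i → s'.natArr T i = if i = s.natReg 10 then s.natReg 11 else s.natArr T i := by
  let p := s.natReg 10
  let I : Store → Prop := fun s' => s'.realArr = s.realArr ∧ s'.natReg 10 < M ∧
    (∀ i, 1 ≤ i → i < M → i ≠ s'.natReg 10 →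
      s'.natArr T i = pick r (s'.natArr T (i + i)) (s'.natArr T (i + i + 1))) ∧
    ∀ i, M ≤ i → s'.natArr T i = if i = p then s.natReg 11 else s.natArr T i
  have hstep : ∀ s', I s' → (Test.natLe (.const 1) (.reg 10)).Holds s' →
      Runs (climb T B) s' (climb T B).maxTime
        fun s'' => I s'' ∧ (s''.natReg 10).size < (s'.natReg 10).size := by
    rintro s' ⟨h1, h2, h3, h4⟩ hb
    simp only [Test.Holds, NatExpr.eval] at hb
    obtain ⟨r1, r2, r3⟩ := climb_result (T := T) (B := B) (r := r) (s := s')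
      (fun s'' h => hB s'' (h.trans h1))
    refine Runs.of_loopFree rfl ⟨⟨r2.trans h1, ?_, ?_, ?_⟩, ?_⟩
    · rw [r1]; omega
    · intro i hi hi' hne
      rw [r1] at hne
      -- Since `i` is not the parent of the rewritten node, neither of its children was touched.
      rw [r3, Function.update_of_ne (a := i + i) (by omega),
        Function.update_of_ne (a := i + i + 1) (by omega)]
      by_cases hc : i = s'.natReg 10
      · rw [hc, Function.update_self]
      · rw [Function.update_of_ne hc, h3 i hi hi' hc]
    · intro i hi
      rw [r3, Function.update_of_ne (by omega), h4 i hi]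
    · rw [r1]; exact size_half_lt hb
  have hinit : Runs (.seq (.setNatArr T (.reg 10) (.reg 11)) (.setNatReg 10 (.half (.reg 10)))) s
      (Program.maxTime (.seq (.setNatArr T (.reg 10) (.reg 11)) (.setNatReg 10 (.half (.reg 10)))))
      fun s' => I s' := by
    refine Runs.of_loopFree rfl ?_
    simp only [Program.result, NatExpr.eval, I, p]
    refine ⟨by simp, by simp; omega, ?_, ?_⟩
    · intro i hi hi' hne
      simp only [Store.setNatArr_natReg, Store.setNatReg_natReg, if_true] at hne
      simp only [Store.setNatReg_natArr, Store.setNatArr_natArr, if_true]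
      rw [Function.update_of_ne (by omega), Function.update_of_ne (by omega),
        Function.update_of_ne (by omega), ht i hi hi']
    · intro i hi
      simp [Function.update_apply]
  have hs : (p / 2).size ≤ (2 * M).size := Nat.size_le_size (by omega)
  refine (hinit.seq fun s' f h => (Runs.loop I (fun s' => (s'.natReg 10).size) hstep h
    (N := (2 * M).size) (Nat.size_le_size (by have := h.2.1; omega)))).mono ?_ ?_
  · simp only [climb, Program.maxTime, Test.cost, NatExpr.cost]
    nlinarith
  · rintro s' - ⟨⟨-, h2, h3, h4⟩, hb⟩
    simp only [Test.Holds, NatExpr.eval] at hb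
    exact ⟨fun i hi hi' => h3 i hi hi' (by omega), h4⟩

/-! ### Range maxima -/

/-- The test for trees in which the larger number wins. -/
def maxTest : Test := .natLe (.reg 13) (.reg 12)

/-- Maxima are described by their upper bounds throughout, so that an empty range has maximum `0`
without a separate case. -/
theorem IsTree.le_iff {M : ℕ} {t : ℕ → ℕ} (h : IsTree (fun a b => b ≤ a) M t) {i : ℕ}
    (hi : 1 ≤ i) (hi' : i < M) (b : ℕ) : t i ≤ b ↔ t (i + i) ≤ b ∧ t (i + i + 1) ≤ b := by
  rw [h i hi hi']
  unfold pick
  split_ifs <;> omega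

/-- Replace register `16` by its maximum with the entry of `T` at the index in register `v`. -/
def absorb (T v : ℕ) : Program :=
  .cond (.natLe (.reg 16) (.get T (.reg v))) (.setNatReg 16 (.get T (.reg v)))
    (.setNatReg 16 (.reg 16))

/-- The idle assignment in the second branch gives both branches the same form. -/
theorem absorb_result (T v : ℕ) (s : Store) :
    (absorb T v).result s = s.setNatReg 16 (max (s.natReg 16) (s.natArr T (s.natReg v))) := by
  by_cases h : s.natReg 16 ≤ s.natArr T (s.natReg v)
  · rw [absorb, Program.result_cond_pos (show (Test.natLe (.reg 16) (.get T (.reg v))).Holds s from h),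
       max_eq_right h]
    rfl
  · rw [absorb, Program.result_cond_neg (show ¬ (Test.natLe (.reg 16) (.get T (.reg v))).Holds s from h),
       max_eq_left (by omega)]
    rfl

/-- The test that register `v` is odd. -/
def oddTest (v : ℕ) : Test :=
  .natLe (.add (.add (.half (.reg v)) (.half (.reg v))) (.const 1)) (.reg v)

/-- An odd left end is a right child whose sibling is outside the range, so it is absorbed alone
before passing to parents. -/
def narrowLeft (T : ℕ) : Program :=
  .seq (.cond (oddTest 14) (.seq (absorb T 14) (.setNatReg 14 (.add (.reg 14) (.const 1)))) .skip)
    (.setNatReg 14 (.half (.reg 14)))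

/-- The right end is exclusive: if it is odd, the last node of the range is a left child whose
sibling is outside. -/
def narrowRight (T : ℕ) : Program :=
  .seq (.cond (oddTest 15) (.seq (.setNatReg 15 (.sub (.reg 15) (.const 1))) (absorb T 15)) .skip)
    (.setNatReg 15 (.half (.reg 15)))

/-- Put into register `16` the maximum of the entries of tree `T` from the index in register `14`
up to, but excluding, the index in register `15`. -/
def query (T : ℕ) : Program :=
  .seq (.setNatReg 16 (.const 0))
    (.loop (.natLe (.add (.reg 14) (.const 1)) (.reg 15)) (.seq (narrowLeft T) (narrowRight T)))

theorem narrowLeft_result (T : ℕ) (s : Store) :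
    ((narrowLeft T).result s).natReg 14 = (s.natReg 14 + 1) / 2 ∧
    ((narrowLeft T).result s).natReg 15 = s.natReg 15 ∧
    ((narrowLeft T).result s).natArr = s.natArr ∧
    ((narrowLeft T).result s).natReg 16 = if s.natReg 14 % 2 = 1 then
      max (s.natReg 16) (s.natArr T (s.natReg 14)) else s.natReg 16 := by
  by_cases h : s.natReg 14 % 2 = 1
  · have h' : s.natReg 14 / 2 + s.natReg 14 / 2 + 1 ≤ s.natReg 14 := by omega
    simp [narrowLeft, oddTest, Program.result, Test.Holds, NatExpr.eval, h, h', absorb_result]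
  · have h' : ¬ s.natReg 14 / 2 + s.natReg 14 / 2 + 1 ≤ s.natReg 14 := by omega
    simp only [narrowLeft, oddTest, Program.result, Test.Holds, NatExpr.eval, h, h', if_false]
    simp
    omega

theorem narrowRight_result (T : ℕ) (s : Store) :
    ((narrowRight T).result s).natReg 15 = s.natReg 15 / 2 ∧
    ((narrowRight T).result s).natReg 14 = s.natReg 14 ∧
    ((narrowRight T).result s).natArr = s.natArr ∧
    ((narrowRight T).result s).natReg 16 = if s.natReg 15 % 2 = 1 then
      max (s.natReg 16) (s.natArr T (s.natReg 15 - 1)) else s.natReg 16 := by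
  by_cases h : s.natReg 15 % 2 = 1
  · have h' : s.natReg 15 / 2 + s.natReg 15 / 2 + 1 ≤ s.natReg 15 := by omega
    simp [narrowRight, oddTest, Program.result, Test.Holds, NatExpr.eval, h, h', absorb_result]
    omega
  · have h' : ¬ s.natReg 15 / 2 + s.natReg 15 / 2 + 1 ≤ s.natReg 15 := by omega
    simp [narrowRight, oddTest, Program.result, Test.Holds, NatExpr.eval, h, h']

/-- Passing from a range of nodes to the range of their parents keeps the maximum, once the
unpaired nodes at both ends are accounted for. -/
theorem IsTree.halve_range {M : ℕ} {t : ℕ → ℕ} (ht : IsTree (fun a b => b ≤ a) M t)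
    {l r : ℕ} (hl : 1 ≤ l) (hr : r ≤ 2 * M) (hlr : l < r) (b : ℕ) :
    (∀ i, l ≤ i → i < r → t i ≤ b) ↔
      (l % 2 = 1 → t l ≤ b) ∧ (r % 2 = 1 → t (r - 1) ≤ b) ∧
        ∀ i, (l + 1) / 2 ≤ i → i < r / 2 → t i ≤ b := by
  constructor
  · intro h
    refine ⟨fun _ => h _ le_rfl hlr, fun _ => h _ (by omega) (by omega), fun i hi hi' => ?_⟩
    exact (ht.le_iff (by omega) (by omega) b).2
      ⟨h _ (by omega) (by omega), h _ (by omega) (by omega)⟩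
  · rintro ⟨h1, h2, h3⟩ i hi hi'
    by_cases e1 : i = l ∧ l % 2 = 1
    · rw [e1.1]; exact h1 e1.2
    by_cases e2 : i = r - 1 ∧ r % 2 = 1
    · rw [e2.1]; exact h2 e2.2
    have := (ht.le_iff (i := i / 2) (by omega) (by omega) b).1 (h3 _ (by omega) (by omega))
    have h4 : i = i / 2 + i / 2 ∨ i = i / 2 + i / 2 + 1 := by omega
    rcases h4 with h4 | h4 <;> rw [h4]
    · exact this.1
    · exact this.2

/-- The invariant is that the common upper bounds of register `16` and of the remaining range stay
the same; `IsTree.halve_range` preserves it. -/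
theorem Runs.query {T : ℕ} {s : Store} {M : ℕ}
    (ht : IsTree (fun a b => b ≤ a) M (s.natArr T)) (hl : 1 ≤ s.natReg 14)
    (hr : s.natReg 15 ≤ 2 * M) :
    Runs (query T) s (((2 * M).size + 2) * 100) fun s' => ∀ b, s'.natReg 16 ≤ b ↔
      ∀ i, s.natReg 14 ≤ i → i < s.natReg 15 → s.natArr T i ≤ b := by
  let t := s.natArr T
  let I : Store → Prop := fun s' => s'.natArr T = t ∧ 1 ≤ s'.natReg 14 ∧ s'.natReg 15 ≤ 2 * M ∧
    ∀ b, (s'.natReg 16 ≤ b ∧ ∀ i, s'.natReg 14 ≤ i → i < s'.natReg 15 → t i ≤ b) ↔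
      ∀ i, s.natReg 14 ≤ i → i < s.natReg 15 → t i ≤ b
  have hstep : ∀ s', I s' → (Test.natLe (.add (.reg 14) (.const 1)) (.reg 15)).Holds s' →
      Runs (.seq (narrowLeft T) (narrowRight T)) s'
        (Program.maxTime (.seq (narrowLeft T) (narrowRight T)))
        fun s'' => I s'' ∧ (s''.natReg 15).size < (s'.natReg 15).size := by
    rintro s' ⟨h1, h2, h3, h4⟩ hb
    simp only [Test.Holds, NatExpr.eval] at hb
    refine Runs.of_loopFree rfl ?_
    simp only [Program.result]
    obtain ⟨l1, l2, l3, l4⟩ := narrowLeft_result T s'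
    obtain ⟨r1, r2, r3, r4⟩ := narrowRight_result T ((narrowLeft T).result s')
    rw [l2] at r1 r4
    rw [l1] at r2
    rw [l3, h1, l4, h1] at r4
    refine ⟨⟨by rw [r3, l3, h1], by omega, by omega, fun b => ?_⟩, ?_⟩
    · rw [← h4, r1, r2, r4, ht.halve_range h2 h3 hb]
      split_ifs with e1 e2 e2 <;> simp [e1, e2] <;> tauto
    · rw [r1]; exact size_half_lt (by omega)
  have hinit : Runs (.setNatReg 16 (.const 0)) s
      (Program.maxTime (.setNatReg 16 (.const 0))) I := by
    refine Runs.of_loopFree rfl ?_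
    simp [Program.result, NatExpr.eval, I, hl, hr, t]
  refine (hinit.seq fun s' f h => (Runs.loop I (fun s' => (s'.natReg 15).size) hstep h
    (N := (2 * M).size) (Nat.size_le_size h.2.2.1))).mono ?_ ?_
  · simp only [narrowLeft, narrowRight, oddTest, absorb, Program.maxTime, Test.cost, NatExpr.cost]
    nlinarith
  · rintro s' - ⟨⟨-, h2, h3, h4⟩, hb⟩ b
    simp only [Test.Holds, NatExpr.eval] at hb
    rw [← h4]
    exact ⟨fun h => ⟨h, fun i _ _ => by omega⟩, fun h => h.1⟩

/-! ### Tournament sort -/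

/-- The index `i` comes before `j` when sorting by `K`, with ties broken by index. -/
def Precedes (K : ℕ → ℝ) (i j : ℕ) : Prop := K i < K j ∨ K i = K j ∧ i < j

theorem Precedes.trans {K : ℕ → ℝ} {i j k : ℕ} (h : Precedes K i j) (h' : Precedes K j k) :
    Precedes K i k := by
  unfold Precedes at *
  grind

theorem Precedes.irrefl {K : ℕ → ℝ} {i : ℕ} : ¬ Precedes K i i := by
  simp [Precedes]

theorem Precedes.total (K : ℕ → ℝ) {i j : ℕ} (h : i ≠ j) : Precedes K i j ∨ Precedes K j i := by
  unfold Precedes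
  rcases lt_trichotomy (K i) (K j) with h1 | h1 | h1 <;> simp [h1]
  omega

open Classical in
/-- The position of `i` when the indices below `N` are sorted by `K`. -/
noncomputable def rankOf (K : ℕ → ℝ) (N i : ℕ) : ℕ :=
  ((Finset.range N).filter fun j => Precedes K j i).card

theorem rankOf_lt {K : ℕ → ℝ} {N i : ℕ} (hi : i < N) : rankOf K N i < N := by
  classical
  calc rankOf K N i < (Finset.range N).card := by
        refine Finset.card_lt_card ⟨Finset.filter_subset _ _, fun h => ?_⟩
        exact Precedes.irrefl (Finset.mem_filter.1 (h (Finset.mem_range.2 hi))).2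
    _ = N := Finset.card_range N

theorem rankOf_lt_of_precedes {K : ℕ → ℝ} {N i j : ℕ} (hi : i < N) (h : Precedes K i j) :
    rankOf K N i < rankOf K N j := by
  classical
  refine Finset.card_lt_card ⟨fun k hk => ?_, fun h' => ?_⟩
  · rw [Finset.mem_filter] at hk ⊢
    exact ⟨hk.1, hk.2.trans h⟩
  · exact Precedes.irrefl (Finset.mem_filter.1 (h' (Finset.mem_filter.2
      ⟨Finset.mem_range.2 hi, h⟩))).2

theorem rankOf_lt_iff {K : ℕ → ℝ} {N i j : ℕ} (hi : i < N) (hj : j < N) :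
    rankOf K N i < rankOf K N j ↔ Precedes K i j := by
  refine ⟨fun h => ?_, rankOf_lt_of_precedes hi⟩
  by_contra hn
  rcases eq_or_ne i j with rfl | hij
  · exact lt_irrefl _ h
  · exact lt_asymm h (rankOf_lt_of_precedes hj ((Precedes.total K hij).resolve_left hn))

theorem rankOf_inj {K : ℕ → ℝ} {N i j : ℕ} (hi : i < N) (hj : j < N)
    (h : rankOf K N i = rankOf K N j) : i = j := by
  by_contra hij
  rcases Precedes.total K hij with h1 | h1
  · have := rankOf_lt_of_precedes hi h1; omega
  · have := rankOf_lt_of_precedes hj h1; omega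

theorem exists_rankOf_eq (K : ℕ → ℝ) {N p : ℕ} (hp : p < N) : ∃ i < N, rankOf K N i = p := by
  have hinj : Function.Injective fun i : Fin N => (⟨rankOf K N i, rankOf_lt i.2⟩ : Fin N) :=
    fun i j h => Fin.ext (rankOf_inj i.2 j.2 (congrArg Fin.val h))
  obtain ⟨i, hi⟩ := Finite.injective_iff_surjective.1 hinj ⟨p, hp⟩
  exact ⟨i, i.2, congrArg Fin.val hi⟩

/-- Entries of the sorting tree: `0` is vacant and `i + 1` stands for the index `i`. -/
def SortsBefore (K : ℕ → ℝ) (a b : ℕ) : Prop := b = 0 ∨ a ≠ 0 ∧ ¬ Precedes K (b - 1) (a - 1)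

theorem SortsBefore.total (K : ℕ → ℝ) (a b : ℕ) : SortsBefore K a b ∨ SortsBefore K b a := by
  unfold SortsBefore
  by_cases h : Precedes K (b - 1) (a - 1)
  · have : ¬ Precedes K (a - 1) (b - 1) := fun h' => Precedes.irrefl (h.trans h')
    tauto
  · tauto

theorem SortsBefore.trans (K : ℕ → ℝ) (a b c : ℕ) (h : SortsBefore K a b)
    (h' : SortsBefore K b c) : SortsBefore K a c := by
  unfold SortsBefore at *
  rcases h' with h' | ⟨h1, h2⟩
  · exact .inl h'
  · obtain ⟨h3, h4⟩ := h.resolve_left h1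
    refine .inr ⟨h3, fun h5 => ?_⟩
    rcases eq_or_ne (c - 1) (b - 1) with e | e
    · exact h4 (e ▸ h5)
    · exact h4 (((Precedes.total K e).resolve_left h2).trans h5)

/-- The test `SortsBefore` for the keys in the real array `K`. -/
def sortTest (K : ℕ) : Test :=
  .neg (.conj (.natLe (.const 1) (.reg 13)) (.neg (.conj (.natLe (.const 1) (.reg 12))
    (.conj (.realLe (.get K (.sub (.reg 12) (.const 1))) (.get K (.sub (.reg 13) (.const 1))))
      (.neg (.conj
        (.realLe (.get K (.sub (.reg 13) (.const 1))) (.get K (.sub (.reg 12) (.const 1))))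
        (.natLe (.add (.reg 13) (.const 1)) (.reg 12))))))))

/-- Tests offer only `≤`, negation and conjunction. For nonvacant entries the test amounts to `K a ≤
K b` without both `K b ≤ K a` and `b < a`. -/
theorem sortTest_holds (K : ℕ) (s : Store) :
    (sortTest K).Holds s ↔ SortsBefore (s.realArr K) (s.natReg 12) (s.natReg 13) := by
  simp only [sortTest, Test.Holds, NatExpr.eval, RealExpr.eval, SortsBefore, Precedes]
  generalize s.natReg 12 = a
  generalize s.natReg 13 = b
  rcases b with _ | b
  · simp
  rcases a with _ | a
  · simp
  simp only [Nat.add_sub_cancel]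
  generalize s.realArr K a = x
  generalize s.realArr K b = y
  have e : b + 1 + 1 ≤ a + 1 ↔ b < a := by omega
  rw [e]
  have e2 : x ≤ y ↔ ¬ y < x := not_lt.symm
  have e3 : y = x ↔ ¬ y < x ∧ y ≤ x := by
    rw [not_lt, and_comm]; exact le_antisymm_iff
  rw [e2, e3]
  simp
  tauto

/-- Enter the indices below register `20` into tree `T`. -/
def sortFillBody (K T : ℕ) : Program :=
  .seq (.seq (.setNatReg 10 (.add (.reg 20) (.reg 21))) (.setNatReg 11 (.add (.reg 21) (.const 1))))
  (.seq (update T (sortTest K)) (.setNatReg 21 (.add (.reg 21) (.const 1))))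

/-- Remove the first index from tree `T`, and record its position in the array `P` and the
index in the array `V`. -/
def sortDrainBody (K T P V : ℕ) : Program :=
  .seq (.seq (.setNatReg 22 (.sub (.get T (.const 1)) (.const 1)))
    (.seq (.setNatArr P (.reg 22) (.reg 21)) (.seq (.setNatArr V (.reg 21) (.reg 22))
    (.seq (.setNatReg 10 (.add (.reg 20) (.reg 22))) (.setNatReg 11 (.const 0))))))
  (.seq (update T (sortTest K)) (.setNatReg 21 (.add (.reg 21) (.const 1))))

/-- Sort the indices below register `20` by the keys in the real array `K`, using the array `T` for
a tree, and write the positions to the array `P` and the inverse permutation to the array `V`. -/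
def sort (K T P V : ℕ) : Program :=
  .seq (.setNatReg 21 (.const 0))
  (.seq (.loop (.natLe (.add (.reg 21) (.const 1)) (.reg 20)) (sortFillBody K T))
  (.seq (.setNatReg 21 (.const 0))
  (.loop (.natLe (.add (.reg 21) (.const 1)) (.reg 20)) (sortDrainBody K T P V))))

theorem sortTest_holds_of_eq {K : ℕ} {s s' : Store} (h : s'.realArr = s.realArr) :
    (sortTest K).Holds s' ↔ SortsBefore (s.realArr K) (s'.natReg 12) (s'.natReg 13) := by
  rw [sortTest_holds, h]

theorem sortFillBody_runs {K T : ℕ} {s : Store} {N k : ℕ} (h20 : s.natReg 20 = N)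
    (h21 : s.natReg 21 = k) (hk : k < N)
    (ht : IsTree (SortsBefore (s.realArr K)) N (s.natArr T))
    (hl : ∀ i < N, s.natArr T (N + i) = if i < k then i + 1 else 0) :
    Runs (sortFillBody K T) s (((2 * N).size + 2) * 100) fun s' =>
      s'.natReg 21 = k + 1 ∧ IsTree (SortsBefore (s.realArr K)) N (s'.natArr T) ∧
      ∀ i < N, s'.natArr T (N + i) = if i < k + 1 then i + 1 else 0 := by
  refine Runs.le (Runs.seq (Runs.eq_result rfl) fun s1 f1 e1 => Runs.seq (Runs.update (M := N)
    (r := SortsBefore (s.realArr K)) (fun s' h => sortTest_holds_of_eq ?_) ?_ ?_ ?_)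
    fun s2 f2 h2 => Runs.of_loopFree rfl ?_) ?_
  · rw [h, e1]; rfl
  · rw [e1]; exact ht
  · simp [e1, Program.result, NatExpr.eval, h20]
  · simp [e1, Program.result, NatExpr.eval, h20, h21]; omega
  · have e2 : s2.natReg 21 = k := by
      rw [f2.natReg 21 rfl, f1.natReg 21 rfl, h21]
    simp only [Program.result, NatExpr.eval, Store.setNatReg_natReg, Store.setNatReg_natArr, e2]
    refine ⟨rfl, h2.1, fun i hi => ?_⟩
    rw [h2.2 _ (by omega), f1.natArr T rfl, hl i hi]
    simp [e1, Program.result, NatExpr.eval, h20, h21]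
    grind
  · simp only [sortTest, Program.maxTime, Test.cost, RealExpr.cost, NatExpr.cost]
    omega

theorem sortDrainBody_runs {K T P V : ℕ} (hTP : T ≠ P) (hTV : T ≠ V) (hPV : P ≠ V)
    {s : Store} {N k : ℕ} (h20 : s.natReg 20 = N)
    (h21 : s.natReg 21 = k) (hk : k < N)
    (ht : IsTree (SortsBefore (s.realArr K)) N (s.natArr T))
    (hl : ∀ i < N, s.natArr T (N + i) = if rankOf (s.realArr K) N i < k then 0 else i + 1)
    (hd : ∀ i < N, rankOf (s.realArr K) N i < k → s.natArr P i = rankOf (s.realArr K) N i ∧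
      s.natArr V (rankOf (s.realArr K) N i) = i) :
    Runs (sortDrainBody K T P V) s (((2 * N).size + 2) * 100) fun s' =>
      s'.natReg 21 = k + 1 ∧ IsTree (SortsBefore (s.realArr K)) N (s'.natArr T) ∧
      (∀ i < N, s'.natArr T (N + i) = if rankOf (s.realArr K) N i < k + 1 then 0 else i + 1) ∧
      (∀ i < N, rankOf (s.realArr K) N i < k + 1 → s'.natArr P i = rankOf (s.realArr K) N i ∧
        s'.natArr V (rankOf (s.realArr K) N i) = i) := by
  obtain ⟨a, ha, hak⟩ := exists_rankOf_eq (s.realArr K) hk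
  -- The root is the entry of some leaf and is at least as good as the leaf of `a`, which is still
  -- occupied. So it is not vacant, and its index has rank at most `k`; every remaining index has
  -- rank at least `k`.
  have hroot : s.natArr T 1 = a + 1 := by
    obtain ⟨q, hq1, hq2, hq⟩ := ht.exists_leaf (2 * N) 1 le_rfl (by omega) (by omega)
    have h1 := ht.root_le (SortsBefore.total _) (SortsBefore.trans _) (N + a) (by omega) (by omega)
    rw [hl a ha, if_neg (by omega)] at h1
    obtain ⟨i, rfl⟩ : ∃ i, q = N + i := ⟨q - N, by omega⟩
    have hi : i < N := by omega
    rw [hl i hi] at hq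
    split_ifs at hq with h2
    · rw [hq] at h1
      simp [SortsBefore] at h1
    · rw [hq] at h1 ⊢
      simp only [SortsBefore, Nat.add_sub_cancel] at h1
      have h3 := (h1.resolve_left (by omega)).2
      rw [← rankOf_lt_iff ha hi] at h3
      rw [rankOf_inj (K := s.realArr K) hi ha (by omega)]
  refine Runs.le (Runs.seq (Runs.eq_result rfl) fun s1 f1 e1 => Runs.seq (Runs.update (M := N)
    (r := SortsBefore (s.realArr K)) (fun s' h => sortTest_holds_of_eq ?_) ?_ ?_ ?_)
    fun s2 f2 h2 => Runs.of_loopFree rfl ?_) ?_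
  · rw [h, e1]; rfl
  · rw [f1.natArr T (by simp [Program.writesNatArr, hTP, hTV])]; exact ht
  · simp [e1, Program.result, NatExpr.eval, h20]
  · simp [e1, Program.result, NatExpr.eval, h20, hroot]; omega
  · have e2 : s2.natReg 21 = k := by
      rw [f2.natReg 21 rfl, f1.natReg 21 rfl, h21]
    have e10 : s1.natReg 10 = N + a := by simp [e1, Program.result, NatExpr.eval, h20, hroot]
    have e11 : s1.natReg 11 = 0 := by simp [e1, Program.result, NatExpr.eval]
    have eP : s1.natArr P = Function.update (s.natArr P) a k := by
      simp [e1, Program.result, NatExpr.eval, hroot, h21, hPV]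
    have eV : s1.natArr V = Function.update (s.natArr V) k a := by
      simp [e1, Program.result, NatExpr.eval, hroot, h21, hPV.symm]
    simp only [Program.result, NatExpr.eval, Store.setNatReg_natReg, Store.setNatReg_natArr, e2]
    refine ⟨rfl, h2.1, fun i hi => ?_, fun i hi hik => ?_⟩
    · rw [h2.2 _ (by omega), f1.natArr T (by simp [Program.writesNatArr, hTP, hTV]), hl i hi,
        e10, e11]
      by_cases hia : i = a
      · subst hia; simp [hak]
      · have : rankOf (s.realArr K) N i ≠ k := fun h => hia (rankOf_inj hi ha (h.trans hak.symm))
        have e3 : rankOf (s.realArr K) N i < k + 1 ↔ rankOf (s.realArr K) N i < k := by omega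
        simp [hia, e3]
    · rw [f2.natArr P (by simp [update, climb, Program.writesNatArr, hTP.symm]),
        f2.natArr V (by simp [update, climb, Program.writesNatArr, hTV.symm]), eP, eV]
      by_cases hia : i = a
      · subst hia; simp [hak]
      · have : rankOf (s.realArr K) N i ≠ k := fun h => hia (rankOf_inj hi ha (h.trans hak.symm))
        rw [Function.update_of_ne hia, Function.update_of_ne this]
        exact hd i hi (by omega)
  · simp only [sortTest, Program.maxTime, Test.cost, RealExpr.cost, NatExpr.cost]
    omega

/-- The two invariants say which leaves are occupied: the indices entered so far while filling, and
those of rank not yet reached while draining. The tree array must start blank, so each call is given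
one of its own. -/
theorem Runs.sort {K T P V : ℕ} (hTP : T ≠ P) (hTV : T ≠ V) (hPV : P ≠ V) {s : Store}
    (hT : s.natArr T = fun _ => 0) {N : ℕ} (h20 : s.natReg 20 = N) :
    Runs (sort K T P V) s ((N + 1) * ((2 * N).size + 2) * 300) fun s' =>
      ∀ i < N, s'.natArr P i = rankOf (s.realArr K) N i ∧
        s'.natArr V (rankOf (s.realArr K) N i) = i := by
  let κ := s.realArr K
  let I1 : Store → Prop := fun s' => s'.realArr K = κ ∧ s'.natReg 20 = N ∧ s'.natReg 21 ≤ N ∧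
    IsTree (SortsBefore κ) N (s'.natArr T) ∧
    ∀ i < N, s'.natArr T (N + i) = if i < s'.natReg 21 then i + 1 else 0
  let I2 : Store → Prop := fun s' => s'.realArr K = κ ∧ s'.natReg 20 = N ∧ s'.natReg 21 ≤ N ∧
    IsTree (SortsBefore κ) N (s'.natArr T) ∧
    (∀ i < N, s'.natArr T (N + i) = if rankOf κ N i < s'.natReg 21 then 0 else i + 1) ∧
    (∀ i < N, rankOf κ N i < s'.natReg 21 → s'.natArr P i = rankOf κ N i ∧
        s'.natArr V (rankOf κ N i) = i)
  have hstep1 : ∀ s', I1 s' → (Test.natLe (.add (.reg 21) (.const 1)) (.reg 20)).Holds s' →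
      Runs (sortFillBody K T) s' (((2 * N).size + 2) * 100)
        fun s'' => I1 s'' ∧ N - s''.natReg 21 < N - s'.natReg 21 := by
    rintro s' ⟨h1, h2, h3, h4, h5⟩ hb
    simp only [Test.Holds, NatExpr.eval, h2] at hb
    refine (sortFillBody_runs (K := K) (k := s'.natReg 21) h2 rfl hb (by rwa [h1]) h5).mono le_rfl ?_
    rintro s'' f ⟨g1, g2, g3⟩
    refine ⟨⟨?_, ?_, by omega, ?_, ?_⟩, by omega⟩
    · rw [f.realArr K rfl, h1]
    · rw [f.natReg 20 rfl, h2]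
    · rwa [← h1]
    · rwa [g1]
  have hstep2 : ∀ s', I2 s' → (Test.natLe (.add (.reg 21) (.const 1)) (.reg 20)).Holds s' →
      Runs (sortDrainBody K T P V) s' (((2 * N).size + 2) * 100)
        fun s'' => I2 s'' ∧ N - s''.natReg 21 < N - s'.natReg 21 := by
    rintro s' ⟨h1, h2, h3, h4, h5, h6⟩ hb
    simp only [Test.Holds, NatExpr.eval, h2] at hb
    refine (sortDrainBody_runs (K := K) (k := s'.natReg 21) hTP hTV hPV h2 rfl hb (by rwa [h1])
      (by rwa [h1]) (by rwa [h1])).mono le_rfl ?_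
    rintro s'' f ⟨g1, g2, g3, g4⟩
    rw [h1] at g2 g3 g4
    refine ⟨⟨?_, ?_, by omega, g2, ?_, ?_⟩, by omega⟩
    · rw [f.realArr K rfl, h1]
    · rw [f.natReg 20 rfl, h2]
    · rwa [g1]
    · rwa [g1]
  refine (Runs.seq (Q := I1) (Runs.of_loopFree rfl ?_) fun s1 f1 e1 =>
    Runs.seq (Runs.loop I1 (fun s' => N - s'.natReg 21) hstep1 e1 (Nat.sub_le _ _))
      fun s2 f2 h2 => Runs.seq (Q := I2) (Runs.of_loopFree rfl ?_) fun s3 f3 h3 =>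
        Runs.loop I2 (fun s' => N - s'.natReg 21) hstep2 h3 (Nat.sub_le _ _)).mono ?_ ?_
  · refine ⟨rfl, by simpa [Program.result] using h20, by simp [Program.result, NatExpr.eval], ?_, ?_⟩
    · simp only [Program.result, Store.setNatReg_natArr, hT]
      exact isTree_zero _ _
    · simp [Program.result, hT, NatExpr.eval]
  · obtain ⟨⟨h1, h2, h3, h4, h5⟩, hb⟩ := h2
    simp only [Test.Holds, NatExpr.eval, h2] at hb
    refine ⟨h1, h2, by simp [Program.result, NatExpr.eval], h4, ?_, ?_⟩
    · intro i hi
      simp [Program.result, h5 i hi, NatExpr.eval]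
      omega
    · simp [Program.result, NatExpr.eval]
  · simp only [Program.maxTime, Test.cost, NatExpr.cost]
    nlinarith [Nat.zero_le (2 * N).size, Nat.zero_le (N * (2 * N).size)]
  · rintro s' - ⟨⟨-, h2, h3, -, -, h6⟩, hb⟩ i hi
    simp only [Test.Holds, NatExpr.eval, h2] at hb
    exact h6 i hi (by have := rankOf_lt (K := κ) hi; omega)

/-! ### The approximation ratio -/

/-- The instance in terms of ranks: `ρ i` and `σ j` are the positions of ray `i` and segment `j` in
the horizontal order, `y i` is the position of ray `i` in the vertical order and `lo j`, `hi j` are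
those of the endpoints of segment `j`. -/
structure Ranks where
  ρ : ℕ → ℕ
  y : ℕ → ℕ
  σ : ℕ → ℕ
  lo : ℕ → ℕ
  hi : ℕ → ℕ

/-- Ray `i` is at the height of segment `j`. -/
def Ranks.Meets (D : Ranks) (i j : ℕ) : Prop := D.lo j < D.y i ∧ D.y i < D.hi j

/-- Ray `i` intersects segment `j`. -/
def Ranks.Stabs (D : Ranks) (i j : ℕ) : Prop := D.σ j < D.ρ i ∧ D.Meets i j

/-- A set of rays is at most twice as large as any solution, if each of its members is the rightmost
ray at the height of some segment that no member further left intersects. -/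
theorem Ranks.card_le_two_mul (D : Ranks) {n m : ℕ} (hρ : ∀ i < n, ∀ i' < n, D.ρ i = D.ρ i' → i = i')
    (A S : Finset (Fin n))
    (hA : ∀ i ∈ A, ∃ j < m, D.Meets i j ∧ (∀ i' < n, D.Meets i' j → D.ρ i' ≤ D.ρ i) ∧
      ∀ i' ∈ A, D.ρ i' < D.ρ i → ¬ D.Stabs i' j)
    (hS : ∀ j < m, ∃ i ∈ S, D.Stabs i j) : A.card ≤ 2 * S.card := by
  classical
  choose! w hw1 hw2 hw3 hw4 using hA
  have hex : ∀ i ∈ A, ∃ i0 ∈ S, D.Stabs i0 (w i) := fun i hi => hS _ (hw1 i hi)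
  choose! f hf1 hf2 using hex
  -- The common charged ray lies at the height of both witnesses; `i` is outside the span of the
  -- witness of `i'` and vice versa, which is impossible for two heights on the same side of it.
  have key : ∀ i ∈ A, ∀ i' ∈ A, D.ρ i < D.ρ i' → f i = f i' →
      (D.y (f i) ≤ D.y i ↔ D.y (f i') ≤ D.y i') → False := by
    intro i hi i' hi' hlt hff hiff
    have h1 := hf2 i hi
    have h2 := hf2 i' hi'
    rw [← hff] at h2 hiff
    have h3 := hw3 i hi _ (f i).2 h1.2
    have h4 := hw4 i' hi' i hi hlt
    have h5 := hw3 i hi _ i'.2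
    have h6 := hw2 i hi
    have h7 := hw2 i' hi'
    simp only [Ranks.Stabs, Ranks.Meets] at *
    omega
  have hcard : A.card ≤ (S ×ˢ (Finset.univ : Finset Bool)).card := by
    refine Finset.card_le_card_of_injOn (fun i => (f i, decide (D.y (f i) ≤ D.y i)))
      (fun i hi => Finset.mem_product.2 ⟨hf1 i hi, Finset.mem_univ _⟩) ?_
    intro i hi i' hi' h
    simp only [Prod.mk.injEq, decide_eq_decide] at h
    rcases lt_trichotomy (D.ρ i) (D.ρ i') with h1 | h1 | h1
    · exact (key i hi i' hi' h1 h.1 h.2).elim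
    · exact Fin.ext (hρ i i.2 i' i'.2 h1)
    · exact (key i' hi' i hi h1 h.1.symm h.2.symm).elim
  rw [Finset.card_product, Finset.card_univ, Fintype.card_bool] at hcard
  omega

/-! ### Trees of rays -/

/-- The tree `t` over the vertical order holds the rays in `A`, a ray `i` being entered as
`D.ρ i + 1`. -/
def Ranks.Holds (D : Ranks) (M : ℕ) (t : ℕ → ℕ) (A : ℕ → Prop) : Prop :=
  IsTree (fun a b => b ≤ a) M t ∧
    ∀ q < M, ∀ b, t (M + q) ≤ b ↔ ∀ i, A i → D.y i = q → D.ρ i + 1 ≤ b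

theorem Ranks.holds_empty (D : Ranks) (M : ℕ) {A : ℕ → Prop} (hA : ∀ i, ¬ A i) :
    D.Holds M (fun _ => 0) A :=
  ⟨isTree_zero _ _, fun q _ b => by simp [hA]⟩

theorem Ranks.runs_insert {D : Ranks} {T M : ℕ} {A : ℕ → Prop} {s : Store}
    (h : D.Holds M (s.natArr T) A) {i : ℕ} (hi : D.y i < M)
    (hinj : ∀ i', A i' → D.y i' = D.y i → i' = i)
    (h10 : s.natReg 10 = M + D.y i) (h11 : s.natReg 11 = D.ρ i + 1) :
    Runs (update T maxTest) s (((2 * M).size + 2) * 50) fun s' =>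
      D.Holds M (s'.natArr T) fun i' => A i' ∨ i' = i := by
  refine (Runs.update (r := fun a b => b ≤ a) (M := M) (fun s' _ => Iff.rfl) h.1 (by omega)
    (by omega)).mono ?_ ?_
  · simp [maxTest, Test.cost, NatExpr.cost]
  · rintro s' - ⟨h1, h2⟩
    refine ⟨h1, fun q hq b => ?_⟩
    rw [h2 _ (by omega), h10, h11]
    by_cases hqi : q = D.y i
    · rw [if_pos (by omega)]
      constructor
      · rintro hb i' (hi' | rfl) hy
        · rw [hinj i' hi' (hy.trans hqi)]; exact hb
        · exact hb
      · exact fun hb => hb i (.inr rfl) hqi.symm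
    · rw [if_neg (by omega), h.2 q hq b]
      constructor
      · rintro hb i' (hi' | rfl) hy
        · exact hb i' hi' hy
        · exact absurd hy.symm hqi
      · exact fun hb i' hi' => hb i' (.inl hi')

/-- The leaves strictly between the two endpoint ranks are exactly those at the height of the
segment, whence the `+ 1` at the left end of the half-open range. -/
theorem Ranks.runs_query {D : Ranks} {T M : ℕ} {A : ℕ → Prop} {s : Store}
    (h : D.Holds M (s.natArr T) A) (hA : ∀ i, A i → D.y i < M) {j : ℕ} (hj : D.hi j < M)
    (h14 : s.natReg 14 = M + D.lo j + 1) (h15 : s.natReg 15 = M + D.hi j) :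
    Runs (query T) s (((2 * M).size + 2) * 100) fun s' =>
      ∀ b, s'.natReg 16 ≤ b ↔ ∀ i, A i → D.Meets i j → D.ρ i + 1 ≤ b := by
  refine (Runs.query h.1 (by omega) (by omega)).mono le_rfl fun s' _ hs' b => ?_
  rw [hs']
  constructor
  · rintro hb i hi ⟨h1, h2⟩
    exact (h.2 _ (hA i hi) b).1 (hb _ (by omega) (by omega)) i hi rfl
  · intro hb k hk hk'
    obtain ⟨q, rfl⟩ : ∃ q, k = M + q := ⟨k - M, by omega⟩
    refine (h.2 q (by omega) b).2 fun i hi hy => hb i hi ⟨?_, ?_⟩ <;> omega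

/-! ### Counting loops -/

/-- Run `P` with register `v` counting from `0` up to, but excluding, the value of register `w`. -/
def forLoop (v w : ℕ) (P : Program) : Program :=
  .seq (.setNatReg v (.const 0)) (.loop (.natLe (.add (.reg v) (.const 1)) (.reg w))
    (.seq P (.setNatReg v (.add (.reg v) (.const 1)))))

/-- The premise `hI` makes the invariant insensitive to the counter register, whose value is passed
as the argument `k` instead. -/
theorem Runs.forLoop {v w : ℕ} {P : Program} {s : Store} {N c : ℕ} (I : ℕ → Store → Prop)
    (hv : P.writesNatReg v = false) (hw : P.writesNatReg w = false) (hvw : v ≠ w)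
    (hN : s.natReg w = N) (h0 : I 0 s) (hI : ∀ k s' x, I k s' → I k (s'.setNatReg v x))
    (hstep : ∀ k s', k < N → Frame (forLoop v w P) s s' → s'.natReg v = k → I k s' →
      Runs P s' c (I (k + 1))) :
    Runs (forLoop v w P) s ((N + 1) * (c + 20)) (I N) := by
  let J : Store → Prop := fun s' => Frame (SSR.forLoop v w P) s s' ∧ s'.natReg v ≤ N ∧
    I (s'.natReg v) s'
  have hPw : (SSR.forLoop v w P).writesNatReg w = false := by
    simp [SSR.forLoop, Program.writesNatReg, hw, hvw.symm]
  have hloop : ∀ s', J s' → (Test.natLe (.add (.reg v) (.const 1)) (.reg w)).Holds s' →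
      Runs (.seq P (.setNatReg v (.add (.reg v) (.const 1)))) s' (c + 4)
        fun s'' => J s'' ∧ N - s''.natReg v < N - s'.natReg v := by
    rintro s' ⟨h1, h2, h3⟩ hb
    simp only [Test.Holds, NatExpr.eval, h1.natReg w hPw, hN] at hb
    refine (Runs.seq (Q := fun s'' => I (s'.natReg v + 1) s'') (hstep _ s' hb h1 rfl h3)
      fun s1 f1 h4 => Runs.of_loopFree rfl
        (Q := fun s'' => s''.natReg v = s'.natReg v + 1 ∧ I (s'.natReg v + 1) s'') ?_).mono
      (by simp [Program.maxTime, NatExpr.cost]) ?_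
    · simp only [Program.result, NatExpr.eval, f1.natReg v hv]
      exact ⟨by simp, hI _ _ _ h4⟩
    · rintro s'' f ⟨h5, h6⟩
      refine ⟨⟨h1.trans (f.of_imp ?_ ?_ ?_ ?_), by omega, by rwa [h5]⟩, by omega⟩ <;>
      · intro a ha
        simp_all [SSR.forLoop, Program.writesNatReg, Program.writesNatArr, Program.writesRealReg,
          Program.writesRealArr]
  refine (Runs.seq (Q := J) (Runs.of_loopFree rfl ?_) fun s1 f1 h1 =>
    Runs.loop J (fun s' => N - s'.natReg v) hloop h1 (Nat.sub_le _ _)).mono ?_ ?_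
  · refine ⟨⟨fun a ha => ?_, fun _ _ => rfl, fun _ _ => rfl, fun _ _ => rfl⟩,
      by simp [Program.result, NatExpr.eval], ?_⟩
    · have : a ≠ v := by
        rintro rfl
        simp [SSR.forLoop, Program.writesNatReg] at ha
      simp [Program.result, this]
    · simpa [Program.result, NatExpr.eval] using hI 0 s 0 h0
  · simp only [Program.maxTime, Test.cost, NatExpr.cost]
    nlinarith
  · rintro s' - ⟨⟨h1, h2, h3⟩, hb⟩
    simp only [Test.Holds, NatExpr.eval, h1.natReg w hPw, hN] at hb
    have : s'.natReg v = N := by omega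
    rwa [this] at h3

/-! ### The program -/

/-- Put `n + m` into register `2` and `n + 2 * m` into the registers `3` and `20`. -/
def sizesProg : Program :=
  .seq (.setNatReg 2 (.add (.reg 0) (.reg 1)))
  (.seq (.setNatReg 3 (.add (.reg 2) (.reg 1))) (.setNatReg 20 (.reg 3)))

/-- The layout decides ties, which go to the smaller index. Vertical keys are ordered as lower
endpoints, rays, upper endpoints, and horizontal keys as segments, rays, so that closed incidence
becomes strict inequality of ranks. -/
def segKeysBody : Program :=
  .seq (.setRealArr 5 (.reg 30) (.get 3 (.reg 30)))
  (.seq (.setRealArr 5 (.add (.add (.reg 1) (.reg 0)) (.reg 30)) (.get 4 (.reg 30)))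
    (.setRealArr 6 (.reg 30) (.get 2 (.reg 30))))

def rayKeysBody : Program :=
  .seq (.setRealArr 5 (.add (.reg 1) (.reg 30)) (.get 1 (.reg 30)))
    (.setRealArr 6 (.add (.reg 1) (.reg 30)) (.get 0 (.reg 30)))

/-- Write the vertical keys to the real array `5` and the horizontal keys to the real array `6`. -/
def keysProg : Program := .seq (forLoop 30 1 segKeysBody) (forLoop 30 0 rayKeysBody)

def rayTreeBody : Program :=
  .seq (.seq (.setNatReg 10 (.add (.reg 3) (.get 2 (.add (.reg 1) (.reg 30)))))
    (.setNatReg 11 (.add (.get 5 (.add (.reg 1) (.reg 30))) (.const 1)))) (update 7 maxTest)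

/-- Enter all rays into tree `7`. -/
def rayTreeProg : Program := forLoop 30 0 rayTreeBody

/-- The sort takes real keys, while the entries to be sorted by are natural numbers and the machine
has no conversion; hence a table built by repeated addition of `1`. -/
def castBody : Program :=
  .seq (.setRealArr 7 (.reg 30) (.reg 0)) (.setRealReg 0 (.add (.reg 0) (.const 1)))

/-- Tabulate the natural numbers up to `n + m` as reals in the real array `7`. -/
def castProg : Program := .seq (.setNatReg 4 (.add (.reg 2) (.const 1))) (forLoop 30 4 castBody)

def lastBody : Program :=
  .seq (.seq (.setNatReg 14 (.add (.add (.reg 3) (.get 2 (.reg 30))) (.const 1)))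
    (.setNatReg 15 (.add (.reg 3) (.get 2 (.add (.add (.reg 1) (.reg 0)) (.reg 30))))))
  (.seq (query 7)
    (.seq (.setNatArr 8 (.reg 30) (.reg 16)) (.setRealArr 8 (.reg 30) (.get 7 (.reg 16)))))

/-- Write the entry of the rightmost ray at the height of each segment to array `8`, and the same
number to the real array `8`. -/
def lastProg : Program := forLoop 30 1 lastBody

def greedyFind : Program :=
  .seq (.setNatReg 31 (.get 11 (.reg 30)))
  (.seq (.setNatReg 14 (.add (.add (.reg 3) (.get 2 (.reg 31))) (.const 1)))
    (.setNatReg 15 (.add (.reg 3) (.get 2 (.add (.add (.reg 1) (.reg 0)) (.reg 31))))))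

/-- Entries are horizontal ranks plus one, so a ray at the right height hits exactly when its entry
is at least the rank of the segment plus two. The first half says that no selected ray hits, the
second that the rightmost ray does. -/
def greedyTest : Test :=
  .conj (.natLe (.reg 16) (.add (.get 5 (.reg 31)) (.const 1)))
    (.natLe (.add (.get 5 (.reg 31)) (.const 2)) (.get 8 (.reg 31)))

/-- The entry minus one is a horizontal rank; the inverse permutation in array `6` turns it into the
key index `m + i`, from which `m` is subtracted. -/
def greedySelect : Program :=
  .seq (.setNatReg 32 (.sub (.get 6 (.sub (.get 8 (.reg 31)) (.const 1))) (.reg 1)))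
  (.seq (.setNatArr 0 (.reg 32) (.const 1))
  (.seq (.setNatReg 10 (.add (.reg 3) (.get 2 (.add (.reg 1) (.reg 32)))))
    (.setNatReg 11 (.get 8 (.reg 31)))))

def greedyBody : Program :=
  .seq greedyFind (.seq (query 12)
    (.cond greedyTest (.seq greedySelect (update 12 maxTest)) .skip))

/-- Go through the segments in the order of array `11`, and select the rightmost ray at the height
of each segment that no selected ray intersects. -/
def greedyProg : Program := forLoop 30 1 greedyBody

/-- Compute the vertical ranks in array `2` and the horizontal ranks in array `5`. -/
def ranksProg : Program :=
  .seq sizesProg (.seq keysProg (.seq (sort 5 1 2 3) (.seq (.setNatReg 20 (.reg 2))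
    (sort 6 4 5 6))))

/-- Select rays from the ranks. -/
def selectProg : Program :=
  .seq rayTreeProg (.seq castProg (.seq lastProg (.seq (.setNatReg 20 (.reg 1))
    (.seq (sort 8 9 10 11) greedyProg))))

/-- The approximation algorithm. -/
def solver : Program := .seq ranksProg selectProg

/-! ### Correctness of the parts -/

/-- The store holds the sizes and the ranks `D` of an instance with `n` rays and `m` segments. -/
structure Ranks.Stored (D : Ranks) (n m : ℕ) (s : Store) : Prop where
  reg0 : s.natReg 0 = n
  reg1 : s.natReg 1 = m
  reg2 : s.natReg 2 = n + m
  reg3 : s.natReg 3 = n + m + m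
  lo : ∀ j < m, s.natArr 2 j = D.lo j
  y : ∀ i < n, s.natArr 2 (m + i) = D.y i
  hi : ∀ j < m, s.natArr 2 (m + n + j) = D.hi j
  σ : ∀ j < m, s.natArr 5 j = D.σ j
  ρ : ∀ i < n, s.natArr 5 (m + i) = D.ρ i
  inv : ∀ i < n, s.natArr 6 (D.ρ i) = m + i

theorem Ranks.Stored.of_frame {D : Ranks} {n m : ℕ} {s s' : Store} {P : Program}
    (h : D.Stored n m s) (f : Frame P s s')
    (hP : ([0, 1, 2, 3].all fun v => !P.writesNatReg v) = true)
    (hP' : ([2, 5, 6].all fun v => !P.writesNatArr v) = true) : D.Stored n m s' := by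
  simp only [List.all_cons, List.all_nil, Bool.and_true, Bool.and_eq_true, Bool.not_eq_true'] at hP hP'
  obtain ⟨p0, p1, p2, p3⟩ := hP
  obtain ⟨q2, q5, q6⟩ := hP'
  obtain ⟨h0, h1, h2, h3, h4, h5, h6, h7, h8, h9⟩ := h
  constructor
  · rwa [f.natReg _ p0]
  · rwa [f.natReg _ p1]
  · rwa [f.natReg _ p2]
  · rwa [f.natReg _ p3]
  · rwa [f.natArr _ q2]
  · rwa [f.natArr _ q2]
  · rwa [f.natArr _ q2]
  · rwa [f.natArr _ q5]
  · rwa [f.natArr _ q5]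
  · rwa [f.natArr _ q6]

/-- The bounds and the distinctness of ranks. -/
structure Ranks.Proper (D : Ranks) (n m : ℕ) : Prop where
  y_lt : ∀ i < n, D.y i < n + m + m
  hi_lt : ∀ j < m, D.hi j < n + m + m
  ρ_lt : ∀ i < n, D.ρ i < n + m
  y_inj : ∀ i < n, ∀ i' < n, D.y i = D.y i' → i = i'
  ρ_inj : ∀ i < n, ∀ i' < n, D.ρ i = D.ρ i' → i = i'

theorem keysProg_runs {s : Store} {n m : ℕ} (h0 : s.natReg 0 = n) (h1 : s.natReg 1 = m) :
    Runs keysProg s ((n + m + 1) * 100) fun s' =>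
      (∀ j < m, s'.realArr 5 j = s.realArr 3 j ∧ s'.realArr 5 (m + n + j) = s.realArr 4 j ∧
        s'.realArr 6 j = s.realArr 2 j) ∧
      ∀ i < n, s'.realArr 5 (m + i) = s.realArr 1 i ∧ s'.realArr 6 (m + i) = s.realArr 0 i := by
  let I1 : ℕ → Store → Prop := fun k s' => ∀ j < k, s'.realArr 5 j = s.realArr 3 j ∧
    s'.realArr 5 (m + n + j) = s.realArr 4 j ∧ s'.realArr 6 j = s.realArr 2 j
  let I2 : ℕ → Store → Prop := fun k s' => I1 m s' ∧
    ∀ i < k, s'.realArr 5 (m + i) = s.realArr 1 i ∧ s'.realArr 6 (m + i) = s.realArr 0 i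
  refine (Runs.seq (Runs.forLoop (N := m) I1 rfl rfl (by decide) h1 (by simp [I1])
    (fun _ _ _ h => h) (c := segKeysBody.maxTime) ?_) fun s1 f1 g1 => Runs.forLoop (N := n) I2 rfl rfl
      (by decide) ((f1.natReg 0 rfl).trans h0) ⟨g1, by simp⟩ (fun _ _ _ h => h)
      (c := rayKeysBody.maxTime) ?_).mono ?_ ?_
  · intro k s' hk f hv hI
    refine Runs.of_loopFree rfl fun j hj => ?_
    have e3 := f.realArr 3 rfl
    have e4 := f.realArr 4 rfl
    have e2 := f.realArr 2 rfl
    have e0 := (f.natReg 0 rfl).trans h0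
    have e1 := (f.natReg 1 rfl).trans h1
    simp [segKeysBody, Program.result, NatExpr.eval, RealExpr.eval, hv, e0, e1, e2, e3, e4,
      Function.update_apply]
    have := fun h => hI j h
    grind
  · intro k s' hk f hv hI
    refine Runs.of_loopFree rfl ⟨fun j hj => ?_, fun j hj => ?_⟩
    · have e1 := (f.natReg 1 rfl).trans ((f1.natReg 1 rfl).trans h1)
      have := hI.1 j hj
      simp [rayKeysBody, Program.result, NatExpr.eval, RealExpr.eval, hv, e1,
        Function.update_apply]
      grind
    · have e1 := (f.natReg 1 rfl).trans ((f1.natReg 1 rfl).trans h1)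
      have e3 := (f.realArr 1 rfl).trans (f1.realArr 1 rfl)
      have e4 := (f.realArr 0 rfl).trans (f1.realArr 0 rfl)
      simp [rayKeysBody, Program.result, NatExpr.eval, RealExpr.eval, hv, e1, e3, e4,
        Function.update_apply]
      have := fun h => hI.2 j h
      grind
  · simp [segKeysBody, rayKeysBody, Program.maxTime, NatExpr.cost, RealExpr.cost]
    nlinarith
  · exact fun s' _ h => h

theorem rayTreeProg_runs {D : Ranks} {s : Store} {n m : ℕ} (hD : D.Proper n m)
    (hs : D.Stored n m s) (h7 : s.natArr 7 = fun _ => 0) :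
    Runs rayTreeProg s ((n + 1) * (((2 * (n + m + m)).size + 2) * 100)) fun s' =>
      D.Holds (n + m + m) (s'.natArr 7) fun i => i < n := by
  refine (Runs.forLoop (N := n) (c := ((2 * (n + m + m)).size + 2) * 60)
    (fun k s' => D.Holds (n + m + m) (s'.natArr 7) fun i => i < k) rfl rfl (by decide) hs.reg0
    ?_ (fun _ _ _ h => h) ?_).le ?_
  · simp only [h7]
    exact D.holds_empty _ (by simp)
  · intro k s' hk f hv hI
    have hs' := hs.of_frame f rfl rfl
    refine (Runs.seq (Runs.eq_result rfl) fun s1 f1 e1 => Ranks.runs_insert (D := D)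
      (A := fun i => i < k) (i := k) ?_ (hD.y_lt k hk)
      (fun i hi h => hD.y_inj i (by omega) k hk h) ?_ ?_).mono ?_ ?_
    · rw [f1.natArr 7 rfl]; exact hI
    · simp [e1, Program.result, NatExpr.eval, hs'.reg1, hs'.reg3, hv, hs'.y k hk]
    · simp [e1, Program.result, NatExpr.eval, hs'.reg1, hv, hs'.ρ k hk]
    · simp only [Program.maxTime, NatExpr.cost]
      omega
    · intro s'' _ h
      have : (fun i => i < k ∨ i = k) = fun i => i < k + 1 := by
        funext i; apply propext; omega
      rwa [this] at h
  · gcongr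
    omega

theorem castProg_runs {s : Store} {N : ℕ} (h2 : s.natReg 2 = N) (h0 : s.realReg 0 = 0) :
    Runs castProg s ((N + 2) * 50) fun s' => ∀ k ≤ N, s'.realArr 7 k = k := by
  refine (Runs.seq (Runs.eq_result rfl) fun s1 f1 e1 => Runs.forLoop (N := N + 1)
    (c := castBody.maxTime) (fun k s' => s'.realReg 0 = k ∧ ∀ j < k, s'.realArr 7 j = j) rfl rfl
    (by decide) ?_ ?_ (fun _ _ _ h => h) ?_).mono ?_ ?_
  · simp [e1, Program.result, NatExpr.eval, h2]
  · simp [e1, Program.result, h0]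
  · intro k s' hk f hv hI
    refine Runs.of_loopFree rfl ⟨?_, fun j hj => ?_⟩
    · simp [castBody, Program.result, RealExpr.eval, hI.1]
    · simp only [castBody, Program.result, RealExpr.eval, NatExpr.eval, hv, hI.1,
        Store.setRealReg_realArr, Store.setRealArr_realArr, if_true, Function.update_apply]
      split_ifs with h
      · rw [h]
      · exact hI.2 j (by omega)
  · simp [castBody, Program.maxTime, NatExpr.cost, RealExpr.cost]
    omega
  · exact fun s' _ h k hk => h.2 k (by omega)

/-- The number `q` is the largest entry of a ray at the height of segment `j`, or `0`. -/
def Ranks.IsLast (D : Ranks) (n j q : ℕ) : Prop :=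
  ∀ b, q ≤ b ↔ ∀ i < n, D.Meets i j → D.ρ i + 1 ≤ b

theorem lastProg_runs {D : Ranks} {s : Store} {n m : ℕ} (hD : D.Proper n m)
    (hs : D.Stored n m s) (h7 : D.Holds (n + m + m) (s.natArr 7) fun i => i < n)
    (hc : ∀ k ≤ n + m, s.realArr 7 k = k) :
    Runs lastProg s ((m + 1) * (((2 * (n + m + m)).size + 2) * 150)) fun s' =>
      ∀ j < m, D.IsLast n j (s'.natArr 8 j) ∧ s'.realArr 8 j = s'.natArr 8 j := by
  refine (Runs.forLoop (N := m) (c := ((2 * (n + m + m)).size + 2) * 120)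
    (fun k s' => ∀ j < k, D.IsLast n j (s'.natArr 8 j) ∧ s'.realArr 8 j = s'.natArr 8 j) rfl rfl
    (by decide) hs.reg1 (by simp) (fun _ _ _ h => h) ?_).le ?_
  · intro k s' hk f hv hI
    have hs' := hs.of_frame f rfl rfl
    refine (Runs.seq (Runs.eq_result rfl) fun s1 f1 e1 => Runs.seq (Ranks.runs_query (D := D)
      (M := n + m + m) (A := fun i => i < n) (j := k) ?_ hD.y_lt (hD.hi_lt k hk) ?_ ?_)
      fun s2 f2 h2 => Runs.of_loopFree rfl ?_).le ?_
    · rw [f1.natArr 7 rfl, f.natArr 7 rfl]; exact h7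
    · simp [e1, Program.result, NatExpr.eval, hs'.reg3, hv, hs'.lo k hk]
    · simp [e1, Program.result, NatExpr.eval, hs'.reg0, hs'.reg1, hs'.reg3, hv, hs'.hi k hk]
    · intro j hj
      have e30 : s2.natReg 30 = k := by rw [f2.natReg 30 rfl, f1.natReg 30 rfl, hv]
      have e8 : s2.natArr 8 = s'.natArr 8 := by rw [f2.natArr 8 rfl, f1.natArr 8 rfl]
      have e8' : s2.realArr 8 = s'.realArr 8 := by rw [f2.realArr 8 rfl, f1.realArr 8 rfl]
      have e7 : s2.realArr 7 = s.realArr 7 := by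
        rw [f2.realArr 7 rfl, f1.realArr 7 rfl, f.realArr 7 rfl]
      -- The entry lies within the table of reals.
      have hle : s2.natReg 16 ≤ n + m := (h2 _).2 fun i hi _ => hD.ρ_lt i hi
      simp only [Program.result, NatExpr.eval, RealExpr.eval, Store.setRealArr_realArr,
        Store.setRealArr_natArr, Store.setNatArr_natArr, Store.setNatArr_realArr,
        Store.setNatArr_natReg, if_true, e30, e8, e8', e7, hc _ hle, Function.update_apply]
      by_cases hjk : j = k
      · simp only [hjk, if_true]
        exact ⟨h2, trivial⟩
      · simp only [hjk, if_false]
        exact hI j (by omega)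
    · simp only [Program.maxTime, NatExpr.cost, RealExpr.cost]
      omega
  · gcongr
    omega

/-! ### The greedy selection -/

/-- The selection `A` after processing the segments at the first `k` positions: it intersects these
segments as far as possible, and each member was selected for a segment not intersected before. -/
structure Ranks.Greedy (D : Ranks) (n m : ℕ) (pos q : ℕ → ℕ) (k : ℕ) (A : ℕ → Prop) : Prop where
  lt : ∀ i, A i → i < n
  stabs : ∀ j < m, pos j < k → (∃ i < n, D.Stabs i j) → ∃ i, A i ∧ D.Stabs i j
  witness : ∀ i, A i → ∃ j < m, pos j < k ∧ q j = D.ρ i + 1 ∧ D.Meets i j ∧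
    ∀ i', A i' → D.ρ i' < D.ρ i → ¬ D.Stabs i' j

theorem Ranks.Greedy.skip {D : Ranks} {n m : ℕ} {pos q : ℕ → ℕ} {k : ℕ} {A : ℕ → Prop}
    (h : D.Greedy n m pos q k A) (hinj : ∀ j < m, ∀ j' < m, pos j = pos j' → j = j') {j : ℕ}
    (hj : j < m) (hpos : pos j = k) (hA : (∃ i < n, D.Stabs i j) → ∃ i, A i ∧ D.Stabs i j) :
    D.Greedy n m pos q (k + 1) A := by
  refine ⟨h.lt, fun j' hj' hk hex => ?_, fun i hi => ?_⟩
  · by_cases e : pos j' = k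
    · obtain rfl := hinj j' hj' j hj (e.trans hpos.symm)
      exact hA hex
    · exact h.stabs j' hj' (by omega) hex
  · obtain ⟨j', h1, h2, h3⟩ := h.witness i hi
    exact ⟨j', h1, by omega, h3⟩

/-- Old witnesses survive because the processing order is monotone in `q`: the new ray is not to the
left of any ray selected earlier. The new ray has the current segment as witness, which no earlier
selection hits. -/
theorem Ranks.Greedy.select {D : Ranks} {n m : ℕ} {pos q : ℕ → ℕ} {k : ℕ} {A : ℕ → Prop}
    (h : D.Greedy n m pos q k A) (hinj : ∀ j < m, ∀ j' < m, pos j = pos j' → j = j')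
    (hmono : ∀ j < m, ∀ j' < m, pos j < pos j' → q j ≤ q j') {j : ℕ}
    (hj : j < m) (hpos : pos j = k) (hA : ∀ i, A i → ¬ D.Stabs i j) {i0 : ℕ} (hi0 : i0 < n)
    (hq : q j = D.ρ i0 + 1) (hst : D.Stabs i0 j) :
    D.Greedy n m pos q (k + 1) fun i => A i ∨ i = i0 := by
  refine ⟨?_, fun j' hj' hk hex => ?_, ?_⟩
  · rintro i (hi | rfl)
    · exact h.lt i hi
    · exact hi0
  · by_cases e : pos j' = k
    · obtain rfl := hinj j' hj' j hj (e.trans hpos.symm)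
      exact ⟨i0, .inr rfl, hst⟩
    · obtain ⟨i, hi, hi'⟩ := h.stabs j' hj' (by omega) hex
      exact ⟨i, .inl hi, hi'⟩
  · rintro i (hi | rfl)
    · obtain ⟨j', h1, h2, h3, h4, h5⟩ := h.witness i hi
      refine ⟨j', h1, by omega, h3, h4, ?_⟩
      rintro i' (hi' | rfl) hlt
      · exact h5 i' hi' hlt
      · have := hmono j' h1 j hj (by omega)
        omega
    · refine ⟨j, hj, by omega, hq, hst.2, ?_⟩
      rintro i' (hi' | rfl) hlt
      · exact hA i' hi'
      · omega

/-- Array `8` holds the entry `q j` of the rightmost ray at the height of each segment, and array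
`11` lists the segments in the order `pos` of these entries. -/
structure Ranks.Ordered (D : Ranks) (n m : ℕ) (pos q : ℕ → ℕ) (s : Store) : Prop where
  last : ∀ j < m, s.natArr 8 j = q j
  isLast : ∀ j < m, D.IsLast n j (q j)
  list : ∀ j < m, s.natArr 11 (pos j) = j
  surj : ∀ k < m, ∃ j < m, pos j = k
  inj : ∀ j < m, ∀ j' < m, pos j = pos j' → j = j'
  mono : ∀ j < m, ∀ j' < m, pos j < pos j' → q j ≤ q j'

theorem Ranks.Ordered.of_frame {D : Ranks} {n m : ℕ} {pos q : ℕ → ℕ} {s s' : Store} {P : Program}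
    (h : D.Ordered n m pos q s) (f : Frame P s s') (h8 : P.writesNatArr 8 = false)
    (h11 : P.writesNatArr 11 = false) : D.Ordered n m pos q s' :=
  ⟨by rw [f.natArr 8 h8]; exact h.last, h.isLast, by rw [f.natArr 11 h11]; exact h.list,
    h.surj, h.inj, h.mono⟩

/-- The rays marked as selected in the store. -/
def Marked (n : ℕ) (s : Store) (i : ℕ) : Prop := i < n ∧ s.natArr 0 i ≠ 0

theorem greedyBody_runs {D : Ranks} {s : Store} {n m k : ℕ} {pos q : ℕ → ℕ} (hD : D.Proper n m)
    (hs : D.Stored n m s) (ho : D.Ordered n m pos q s) (hk : k < m) (hv : s.natReg 30 = k)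
    (ht : D.Holds (n + m + m) (s.natArr 12) (Marked n s))
    (hg : D.Greedy n m pos q k (Marked n s)) :
    Runs greedyBody s (((2 * (n + m + m)).size + 2) * 300) fun s' =>
      D.Holds (n + m + m) (s'.natArr 12) (Marked n s') ∧
      D.Greedy n m pos q (k + 1) (Marked n s') := by
  obtain ⟨j, hj, hpos⟩ := ho.surj k hk
  have hfind : greedyFind.result s = ((s.setNatReg 31 j).setNatReg 14
      (n + m + m + D.lo j + 1)).setNatReg 15 (n + m + m + D.hi j) := by
    have : s.natArr 11 k = j := by rw [← hpos]; exact ho.list j hj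
    simp [greedyFind, Program.result, NatExpr.eval, hv, this, hs.reg0, hs.reg1, hs.reg3,
      hs.lo j hj, hs.hi j hj]
  refine (Runs.seq (Runs.eq_result rfl) fun s1 f1 e1 => Runs.seq (Ranks.runs_query (D := D)
    (M := n + m + m) (A := Marked n s) (j := j) ?_ (fun i hi => hD.y_lt i hi.1) (hD.hi_lt j hj)
    ?_ ?_) fun s2 f2 h2 => Runs.cond (c := greedySelect.maxTime +
      ((2 * (n + m + m)).size + 2) * 50) ?_ ?_).le ?_
  · rw [f1.natArr 12 rfl]; exact ht
  · simp [e1, hfind]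
  · simp [e1, hfind]
  · intro hb
    have hs2 := (hs.of_frame f1 rfl rfl).of_frame f2 rfl rfl
    have ho2 := (ho.of_frame f1 rfl rfl).of_frame f2 rfl rfl
    have e31 : s2.natReg 31 = j := by rw [f2.natReg 31 rfl, e1, hfind]; simp
    simp only [greedyTest, Test.Holds, NatExpr.eval, e31, hs2.σ j hj, ho2.last j hj] at hb
    have hnot : ∀ i, Marked n s i → ¬ D.Stabs i j := fun i hi hst => by
      have := (h2 _).1 hb.1 i hi hst.2
      have := hst.1
      omega
    -- The test makes `q j` positive, so if no ray attained it, `q j - 1` would be an upper bound as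
    -- well.
    obtain ⟨i, hi, hm, hq⟩ : ∃ i < n, D.Meets i j ∧ q j = D.ρ i + 1 := by
      by_contra hn
      push Not at hn
      have h3 := ((ho.isLast j hj) (q j - 1)).2 fun i hi hm => by
        have := ((ho.isLast j hj) (q j)).1 le_rfl i hi hm
        have := hn i hi hm
        omega
      omega
    have hst : D.Stabs i j := ⟨by omega, hm⟩
    have e0 : s2.natArr 0 = s.natArr 0 := by rw [f2.natArr 0 rfl, f1.natArr 0 rfl]
    have hsel : greedySelect.result s2 = (((s2.setNatReg 32 i).setNatArr 0 i 1).setNatReg 10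
        (n + m + m + D.y i)).setNatReg 11 (D.ρ i + 1) := by
      simp [greedySelect, Program.result, NatExpr.eval, e31, ho2.last j hj, hq, hs2.inv i hi,
        hs2.reg1, hs2.reg3, hs2.y i hi]
    refine Runs.seq (Runs.eq_result rfl) fun s3 f3 e3 => (Ranks.runs_insert (D := D)
      (A := Marked n s) (i := i) ?_ (hD.y_lt i hi)
      (fun i' hi' h => hD.y_inj i' hi'.1 i hi h) ?_ ?_).mono le_rfl ?_
    · rw [f3.natArr 12 rfl, f2.natArr 12 rfl, f1.natArr 12 rfl]; exact ht
    · simp [e3, hsel]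
    · simp [e3, hsel]
    · intro s4 f4 h4
      have eM : Marked n s4 = fun i' => Marked n s i' ∨ i' = i := by
        funext i'
        simp only [Marked, f4.natArr 0 rfl, e3, hsel, Store.setNatReg_natArr,
          Store.setNatArr_natArr, if_true, Function.update_apply, e0]
        apply propext
        by_cases e : i' = i <;> simp [e, hi]
      rw [eM]
      exact ⟨h4, hg.select ho.inj ho.mono hj hpos hnot hi hq hst⟩
  · intro hb
    refine Runs.mono (c := 1) (Q := fun s' => s' = s2) ⟨s2, 1, .skip s2, le_rfl, rfl⟩
      (by simp [greedySelect, Program.maxTime]; omega) ?_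
    rintro s3 - rfl
    have hs2 := (hs.of_frame f1 rfl rfl).of_frame f2 rfl rfl
    have ho2 := (ho.of_frame f1 rfl rfl).of_frame f2 rfl rfl
    have e31 : s3.natReg 31 = j := by rw [f2.natReg 31 rfl, e1, hfind]; simp
    have e0 : s3.natArr 0 = s.natArr 0 := by rw [f2.natArr 0 rfl, f1.natArr 0 rfl]
    have eM : Marked n s3 = Marked n s := by unfold Marked; rw [e0]
    rw [eM, f2.natArr 12 rfl, f1.natArr 12 rfl]
    refine ⟨ht, hg.skip ho.inj hj hpos ?_⟩
    rintro ⟨i, hi, hst⟩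
    simp only [greedyTest, Test.Holds, NatExpr.eval, e31, hs2.σ j hj, ho2.last j hj, h2] at hb
    by_contra hn
    push Not at hn
    refine hb ⟨fun i' hi' hm => ?_, ?_⟩
    · by_contra hlt
      exact hn i' hi' ⟨by omega, hm⟩
    · have := ((ho.isLast j hj) (q j)).1 le_rfl i hi hst.2
      have := hst.1
      omega
  · simp [greedyFind, greedyTest, greedySelect, Program.maxTime, NatExpr.cost, Test.cost]
    omega

theorem greedyProg_runs {D : Ranks} {s : Store} {n m : ℕ} {pos q : ℕ → ℕ} (hD : D.Proper n m)
    (hs : D.Stored n m s) (ho : D.Ordered n m pos q s) (h12 : s.natArr 12 = fun _ => 0)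
    (h0 : s.natArr 0 = fun _ => 0) :
    Runs greedyProg s ((m + 1) * (((2 * (n + m + m)).size + 2) * 320)) fun s' =>
      D.Greedy n m pos q m (Marked n s') := by
  have hM : ∀ i, ¬ Marked n s i := by simp [Marked, h0]
  refine (Runs.forLoop (N := m) (c := ((2 * (n + m + m)).size + 2) * 300)
    (fun k s' => D.Holds (n + m + m) (s'.natArr 12) (Marked n s') ∧
      D.Greedy n m pos q k (Marked n s')) rfl rfl
    (by decide) hs.reg1 ⟨?_, ?_⟩ (fun _ _ _ h => h) ?_).mono ?_ fun s' _ h => h.2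
  · rw [h12]
    exact D.holds_empty _ hM
  · exact ⟨fun i hi => (hM i hi).elim, fun j _ hj => absurd hj (Nat.not_lt_zero _),
      fun i hi => (hM i hi).elim⟩
  · intro k s' hk f hv hI
    exact greedyBody_runs hD (hs.of_frame f rfl rfl) (ho.of_frame f rfl rfl) hk hv hI.1 hI.2
  · gcongr
    omega

/-! ### The ranks of an instance -/

/-- The ranks given by the vertical keys `Y` and the horizontal keys `X`. -/
noncomputable def ranksOf (n m : ℕ) (Y X : ℕ → ℝ) : Ranks where
  ρ i := rankOf X (n + m) (m + i)
  y i := rankOf Y (n + m + m) (m + i)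
  σ j := rankOf X (n + m) j
  lo j := rankOf Y (n + m + m) j
  hi j := rankOf Y (n + m + m) (m + n + j)

theorem ranksOf_proper (n m : ℕ) (Y X : ℕ → ℝ) : (ranksOf n m Y X).Proper n m where
  y_lt i hi := rankOf_lt (by omega)
  hi_lt j hj := rankOf_lt (by omega)
  ρ_lt i hi := rankOf_lt (by omega)
  y_inj i hi i' hi' h := by have := rankOf_inj (by omega) (by omega) h; omega
  ρ_inj i hi i' hi' h := by have := rankOf_inj (by omega) (by omega) h; omega

/-- With the smaller index on the left, a tie of keys counts as smaller rank. -/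
theorem rankOf_lt_iff_le {K : ℕ → ℝ} {N i j : ℕ} (hij : i < j) (hj : j < N) :
    rankOf K N i < rankOf K N j ↔ K i ≤ K j := by
  rw [rankOf_lt_iff (by omega) hj, le_iff_lt_or_eq]
  simp [Precedes, hij]

theorem ranksOf_stabs {n m : ℕ} {Y X : ℕ → ℝ} {i j : ℕ} (hi : i < n) (hj : j < m) :
    (ranksOf n m Y X).Stabs i j ↔
      X j ≤ X (m + i) ∧ Y j ≤ Y (m + i) ∧ Y (m + i) ≤ Y (m + n + j) := by
  simp only [Ranks.Stabs, Ranks.Meets, ranksOf]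
  rw [rankOf_lt_iff_le (by omega) (by omega), rankOf_lt_iff_le (by omega) (by omega),
    rankOf_lt_iff_le (by omega) (by omega)]

theorem inter_nonempty_iff (r : Ray) (v : Segment) :
    (r.carrier ∩ v.carrier).Nonempty ↔ v.x ≤ r.x ∧ v.lo ≤ r.y ∧ r.y ≤ v.hi := by
  constructor
  · rintro ⟨⟨a, b⟩, ⟨h1, h2⟩, h3, h4, h5⟩
    simp only at h1 h2 h3 h4 h5
    subst h2 h3
    exact ⟨h1, h4, h5⟩
  · rintro ⟨h1, h2, h3⟩
    exact ⟨(v.x, r.y), ⟨h1, rfl⟩, rfl, h2, h3⟩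

/-- A greedy selection is a solution at most twice as large as any other. -/
theorem Ranks.Greedy.approx {n m : ℕ} {I : Problem n m} {D : Ranks} {pos q : ℕ → ℕ} {s : Store}
    (hD : D.Proper n m)
    (hI : ∀ (i : Fin n) (j : Fin m),
      ((I.ray i).carrier ∩ (I.seg j).carrier).Nonempty ↔ D.Stabs i j)
    (hq : ∀ j < m, D.IsLast n j (q j)) (hpos : ∀ j < m, pos j < m)
    (hg : D.Greedy n m pos q m (Marked n s)) (hf : I.Feasible) :
    I.IsSolution (s.output n) ∧
      ∀ S : Finset (Fin n), I.IsSolution S → (s.output n).card ≤ 2 * S.card := by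
  have hmem : ∀ i : Fin n, i ∈ s.output n ↔ Marked n s i := fun i => by
    simp [Store.output, Marked]
  refine ⟨fun j => ?_, fun S hS => ?_⟩
  · obtain ⟨i, hi⟩ := hf j
    obtain ⟨i', hi', hst⟩ := hg.stabs j j.2 (hpos j j.2) ⟨i, i.2, (hI i j).1 hi⟩
    exact ⟨⟨i', hi'.1⟩, (hmem _).2 hi', (hI ⟨i', hi'.1⟩ j).2 hst⟩
  · refine D.card_le_two_mul (m := m) hD.ρ_inj _ _ (fun i hi => ?_) fun j hj => ?_
    · obtain ⟨j, hj, -, h1, h2, h3⟩ := hg.witness i ((hmem i).1 hi)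
      refine ⟨j, hj, h2, fun i' hi' hm => ?_, fun i' hi' => h3 i' ((hmem i').1 hi')⟩
      have := (hq j hj (q j)).1 le_rfl i' hi' hm
      omega
    · obtain ⟨i, hi, hst⟩ := hS ⟨j, hj⟩
      exact ⟨i, hi, (hI i ⟨j, hj⟩).1 hst⟩

/-! ### Assembling the program and its total running time -/

theorem ranksProg_runs {s : Store} {n m : ℕ} (h0 : s.natReg 0 = n) (h1 : s.natReg 1 = m)
    (hz : ∀ a, s.natArr a = fun _ => 0) :
    Runs ranksProg s ((2 * (n + m) + 2) * ((4 * (n + m)).size + 2) * 1000) fun s' =>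
      (ranksOf n m (s'.realArr 5) (s'.realArr 6)).Stored n m s' ∧
      (∀ j < m, s'.realArr 5 j = s.realArr 3 j ∧ s'.realArr 5 (m + n + j) = s.realArr 4 j ∧
        s'.realArr 6 j = s.realArr 2 j) ∧
      ∀ i < n, s'.realArr 5 (m + i) = s.realArr 1 i ∧ s'.realArr 6 (m + i) = s.realArr 0 i := by
  have hsizes : sizesProg.result s = ((s.setNatReg 2 (n + m)).setNatReg 3 (n + m + m)).setNatReg 20
      (n + m + m) := by
    simp [sizesProg, Program.result, NatExpr.eval, h0, h1]
  refine Runs.le (Runs.seq (Runs.eq_result rfl) fun s1 f1 e1 =>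
    Runs.seq (keysProg_runs (n := n) (m := m) ?_ ?_) fun s2 f2 h2 =>
    Runs.seq (Runs.sort (N := n + m + m) (by decide) (by decide) (by decide) ?_ ?_)
      fun s3 f3 h3 =>
    Runs.seq (Runs.eq_result rfl) fun s4 f4 e4 =>
    (Runs.sort (N := n + m) (by decide) (by decide) (by decide) ?_ ?_).mono le_rfl
      fun s5 f5 h5 => ?_) ?_
  · simp [e1, hsizes, h0]
  · simp [e1, hsizes, h1]
  · rw [f2.natArr 1 rfl, f1.natArr 1 rfl, hz]
  · rw [f2.natReg 20 rfl, e1, hsizes]; simp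
  · rw [f4.natArr 4 rfl, f3.natArr 4 rfl, f2.natArr 4 rfl, f1.natArr 4 rfl, hz]
  · have : s3.natReg 2 = n + m := by rw [f3.natReg 2 rfl, f2.natReg 2 rfl, e1, hsizes]; simp
    simp [e4, Program.result, NatExpr.eval, this]
  · have eY : s5.realArr 5 = s2.realArr 5 := by
      rw [f5.realArr 5 rfl, f4.realArr 5 rfl, f3.realArr 5 rfl]
    have eX' : s4.realArr 6 = s2.realArr 6 := by rw [f4.realArr 6 rfl, f3.realArr 6 rfl]
    have eX : s5.realArr 6 = s2.realArr 6 := by rw [f5.realArr 6 rfl, eX']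
    have e2 : s5.natArr 2 = s3.natArr 2 := by rw [f5.natArr 2 rfl, f4.natArr 2 rfl]
    have k2 := h2.1
    have k2' := h2.2
    simp only [f1.realArr 0 rfl, f1.realArr 1 rfl, f1.realArr 2 rfl, f1.realArr 3 rfl,
      f1.realArr 4 rfl] at k2 k2'
    rw [eX'] at h5
    rw [eX, eY]
    refine ⟨⟨?_, ?_, ?_, ?_, fun j hj => ?_, fun i hi => ?_, fun j hj => ?_, fun j hj => ?_,
      fun i hi => ?_, fun i hi => ?_⟩, k2, k2'⟩
    · rw [f5.natReg 0 rfl, f4.natReg 0 rfl, f3.natReg 0 rfl, f2.natReg 0 rfl, f1.natReg 0 rfl, h0]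
    · rw [f5.natReg 1 rfl, f4.natReg 1 rfl, f3.natReg 1 rfl, f2.natReg 1 rfl, f1.natReg 1 rfl, h1]
    · rw [f5.natReg 2 rfl, f4.natReg 2 rfl, f3.natReg 2 rfl, f2.natReg 2 rfl, e1, hsizes]; simp
    · rw [f5.natReg 3 rfl, f4.natReg 3 rfl, f3.natReg 3 rfl, f2.natReg 3 rfl, e1, hsizes]; simp
    · rw [e2]; exact (h3 j (by omega)).1
    · rw [e2]; exact (h3 (m + i) (by omega)).1
    · rw [e2]; exact (h3 (m + n + j) (by omega)).1
    · exact (h5 j (by omega)).1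
    · exact (h5 (m + i) (by omega)).1
    · exact (h5 (m + i) (by omega)).2
  · have a1 : (2 * (n + m + m)).size ≤ (4 * (n + m)).size := Nat.size_le_size (by omega)
    have a2 : (2 * (n + m)).size ≤ (4 * (n + m)).size := Nat.size_le_size (by omega)
    have a3 : (n + m + m + 1) * ((2 * (n + m + m)).size + 2) ≤
        (2 * (n + m) + 2) * ((4 * (n + m)).size + 2) := Nat.mul_le_mul (by omega) (by omega)
    have a4 : (n + m + 1) * ((2 * (n + m)).size + 2) ≤
        (2 * (n + m) + 2) * ((4 * (n + m)).size + 2) := Nat.mul_le_mul (by omega) (by omega)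
    have a5 : (2 * (n + m) + 2) * 2 ≤ (2 * (n + m) + 2) * ((4 * (n + m)).size + 2) := Nat.mul_le_mul (by omega) (by omega)
    simp only [sizesProg, Program.maxTime, NatExpr.cost]
    omega

theorem selectProg_runs {D : Ranks} {s : Store} {n m : ℕ} (hD : D.Proper n m)
    (hs : D.Stored n m s) (hz : ∀ a ∈ [0, 7, 9, 12], s.natArr a = fun _ => 0)
    (h0 : s.realReg 0 = 0) :
    Runs selectProg s ((2 * (n + m) + 2) * ((4 * (n + m)).size + 2) * 1000) fun s' =>
      ∃ pos q : ℕ → ℕ, (∀ j < m, D.IsLast n j (q j)) ∧ (∀ j < m, pos j < m) ∧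
        D.Greedy n m pos q m (Marked n s') := by
  refine Runs.le (Runs.seq (rayTreeProg_runs hD hs (hz 7 (by simp))) fun s1 f1 h1 =>
    Runs.seq (castProg_runs (N := n + m) ((f1.natReg 2 rfl).trans hs.reg2)
      ((f1.realReg 0 rfl).trans h0)) fun s2 f2 h2 =>
    have hs2 := (hs.of_frame f1 rfl rfl).of_frame f2 rfl rfl
    Runs.seq (lastProg_runs hD hs2 ?_ h2) fun s3 f3 h3 =>
    Runs.seq (Runs.eq_result rfl) fun s4 f4 e4 =>
    have hs4 := (hs2.of_frame f3 rfl rfl).of_frame f4 rfl rfl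
    Runs.seq (Runs.sort (N := m) (by decide) (by decide) (by decide) ?_ ?_) fun s5 f5 h5 =>
      (greedyProg_runs hD (hs4.of_frame f5 rfl rfl) (pos := rankOf (s4.realArr 8) m)
        (q := s3.natArr 8) ?_ ?_ ?_).mono le_rfl fun s6 _ h6 =>
          ⟨_, _, fun j hj => (h3 j hj).1, fun j hj => rankOf_lt hj, h6⟩) ?_
  · rw [f2.natArr 7 rfl]; exact h1
  · rw [f4.natArr 9 rfl, f3.natArr 9 rfl, f2.natArr 9 rfl, f1.natArr 9 rfl, hz 9 (by simp)]
  · have : s3.natReg 1 = m := (hs2.of_frame f3 rfl rfl).reg1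
    simp [e4, Program.result, NatExpr.eval, this]
  · have e8 : s5.natArr 8 = s3.natArr 8 := by rw [f5.natArr 8 rfl, f4.natArr 8 rfl]
    have e8' : s4.realArr 8 = s3.realArr 8 := f4.realArr 8 rfl
    refine ⟨fun j _ => by rw [e8], fun j hj => (h3 j hj).1, fun j hj => (h5 j hj).2,
      fun k hk => exists_rankOf_eq _ hk, fun j hj j' hj' h => rankOf_inj hj hj' h,
      fun j hj j' hj' h => ?_⟩
    rw [rankOf_lt_iff hj hj', e8'] at h
    unfold Precedes at h
    rw [(h3 j hj).2, (h3 j' hj').2] at h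
    rcases h with h | h
    · exact_mod_cast h.le
    · exact_mod_cast h.1.le
  · rw [f5.natArr 12 rfl, f4.natArr 12 rfl, f3.natArr 12 rfl, f2.natArr 12 rfl, f1.natArr 12 rfl,
      hz 12 (by simp)]
  · rw [f5.natArr 0 rfl, f4.natArr 0 rfl, f3.natArr 0 rfl, f2.natArr 0 rfl, f1.natArr 0 rfl,
      hz 0 (by simp)]
  · have a1 : (2 * (n + m + m)).size ≤ (4 * (n + m)).size := Nat.size_le_size (by omega)
    have a2 : (2 * m).size ≤ (4 * (n + m)).size := Nat.size_le_size (by omega)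
    have a3 : (n + 1 + (m + 1)) * ((2 * (n + m + m)).size + 2) ≤
        (2 * (n + m) + 2) * ((4 * (n + m)).size + 2) := Nat.mul_le_mul (by omega) (by omega)
    have a4 : (m + 1) * ((2 * m).size + 2) ≤
        (2 * (n + m) + 2) * ((4 * (n + m)).size + 2) := Nat.mul_le_mul (by omega) (by omega)
    have a5 : (2 * (n + m) + 2) * 2 ≤ (2 * (n + m) + 2) * ((4 * (n + m)).size + 2) := Nat.mul_le_mul (by omega) (by omega)
    simp only [Program.maxTime, NatExpr.cost]
    nlinarith

theorem solver_runs {n m : ℕ} (I : Problem n m) :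
    Runs solver I.input ((2 * (n + m) + 2) * ((4 * (n + m)).size + 2) * 2000) fun s =>
      I.Feasible → I.IsSolution (s.output n) ∧
        ∀ S : Finset (Fin n), I.IsSolution S → (s.output n).card ≤ 2 * S.card := by
  refine (Runs.seq (ranksProg_runs (n := n) (m := m) rfl rfl fun _ => rfl) fun s1 f1 h1 =>
    (selectProg_runs (ranksOf_proper n m _ _) h1.1 ?_ (f1.realReg 0 rfl)).mono le_rfl
      fun s2 _ h2 hf => ?_).le (by omega)
  · intro a ha
    have : ranksProg.writesNatArr a = false := by
      fin_cases ha <;> rfl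
    rw [f1.natArr a this]
    rfl
  · obtain ⟨-, h3, h4⟩ := h1
    obtain ⟨pos, q, h5, h6, h7⟩ := h2
    refine h7.approx (ranksOf_proper n m _ _) (fun i j => ?_) h5 h6 hf
    rw [inter_nonempty_iff, ranksOf_stabs i.2 j.2, (h3 j j.2).1, (h3 j j.2).2.1, (h3 j j.2).2.2,
      (h4 i i.2).1, (h4 i i.2).2]
    simp [Problem.input, listing]

/-- The function `N ↦ (2 * N + 2) * (Nat.size (4 * N) + 2)` is `O(N log N)`. -/
theorem isBigO_linear_mul_size (C : ℕ) :
    (fun N : ℕ => (((2 * N + 2) * ((4 * N).size + 2) * C : ℕ) : ℝ)) =O[atTop]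
      fun N : ℕ => (N : ℝ) * Real.log (N : ℝ) := by
  refine IsBigO.of_bound (4 * 40 * C) ?_
  filter_upwards [eventually_ge_atTop 3] with N hN
  have hN' : (3 : ℝ) ≤ N := by exact_mod_cast hN
  -- Here `N ≥ 3 > e`; this lets additive constants be absorbed into the logarithm.
  have hlog : 1 ≤ Real.log N := by
    rw [Real.le_log_iff_exp_le (by linarith)]
    linarith [Real.exp_one_lt_d9]
  -- From `2 ^ (size - 1) ≤ 4 * N` and `log 2 > 1 / 2`, the size is at most `1 + 4 * log 2 + 2 * log
  -- N`.
  have hsize : (((4 * N).size : ℕ) : ℝ) ≤ 8 * Real.log N := by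
    have h1 : 2 ^ ((4 * N).size - 1) ≤ 4 * N := by
      have : (4 * N).size - 1 < (4 * N).size := by
        have : 0 < (4 * N).size := Nat.size_pos.2 (by omega)
        omega
      exact Nat.lt_size.1 this
    have h2 : ((2 : ℝ) ^ ((4 * N).size - 1)) ≤ 4 * N := by exact_mod_cast h1
    have h3 := Real.log_le_log (by positivity) h2
    rw [Real.log_pow, Real.log_mul (by norm_num) (by linarith),
      show (4 : ℝ) = 2 ^ 2 by norm_num, Real.log_pow] at h3
    have h4 : (((4 * N).size : ℕ) : ℝ) ≤ (((4 * N).size - 1 : ℕ) : ℝ) + 1 := by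
      exact_mod_cast (by omega : (4 * N).size ≤ (4 * N).size - 1 + 1)
    have h5 := Real.log_two_gt_d9
    have h6 : (((4 * N).size - 1 : ℕ) : ℝ) * (1 / 2) ≤ (((4 * N).size - 1 : ℕ) : ℝ) * Real.log 2 := by
      gcongr
      linarith
    have h7 := Real.log_two_lt_d9
    push_cast at h3
    linarith
  rw [Real.norm_of_nonneg (by positivity), Real.norm_of_nonneg (by positivity)]
  push_cast
  have h1 : (2 * (N : ℝ) + 2) * (((4 * N).size : ℕ) + 2) ≤ (4 * N) * (10 * Real.log N) := by
    gcongr <;> linarith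
  have hC : (0 : ℝ) ≤ C := by positivity
  have h2 : 0 ≤ (N : ℝ) * Real.log N := by positivity
  nlinarith [mul_le_mul_of_nonneg_right h1 hC, mul_nonneg h2 hC]

end SSR

theorem theorem2 :
    ∃ (P : SSR.Program) (T : ℕ → ℕ),
      ((fun N : ℕ => (T N : ℝ)) =O[atTop] fun N : ℕ => (N : ℝ) * Real.log (N : ℝ)) ∧
      ∀ (n m : ℕ) (I : SSR.Problem n m),
        ∃ (s : SSR.Store) (t : ℕ),
          SSR.Exec P I.input s t ∧
          t ≤ T (n + m) ∧
          (I.Feasible →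
            I.IsSolution (s.output n) ∧
            ∀ S : Finset (Fin n), I.IsSolution S → (s.output n).card ≤ 2 * S.card) := by
  exact ⟨SSR.solver, fun N => (2 * N + 2) * ((4 * N).size + 2) * 2000,
    SSR.isBigO_linear_mul_size 2000, fun n m I => SSR.solver_runs I⟩
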